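/- **Setting.** Let $\eta\in[0,1]$. The qubit amplitude damping channel of transmissivity $\eta$ is $$\mathcal A(\rho)=K_0\rho K_0^\dagger+K_1\rho K_1^\dagger,\qquad K_0=\begin{pmatrix}1&0\\0&\sqrt\eta\end{pmatrix},\qquad K_1=\begin{pmatrix}0&\sqrt{1-\eta}\\0&0\end{pmatrix}.$$ For a finite ensemble $\{p_X(x),|\phi^x\rangle_{AA'}\}$ of pure states, with $A$ finite-dimensional and $A'$ a qubit, put $$\rho_{XAB}=\sum_x p_X(x)\,|x\rangle\langle x|_X\otimes(\mathrm{id}_A\otimes\mathcal A_{A'\to B})(|\phi^x\rangle\langle\phi^x|_{AA'}),$$ and, with $H$ the von Neumann entropy to base $2$ of the indicated marginals of $\rho_{XAB}$, $$I(A\rangle BX)=H(BX)-H(ABX),\qquad I(X;B)=H(X)+H(B)-H(BX).$$ The single-letter classical–quantum trade-off region of $\mathcal A$ is the set of pairs $(C,Q)\in\mathbb R^2$ for which some such ensemble satisfies $$Q\le I(A\rangle BX),\qquad C+Q\le I(X;B)+I(A\rangle BX).$$ Let $h_2(y)=-y\log_2y-(1-y)\log_2(1-y)$ and $$\mathsf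 g(q,z,\nu)=h_2\!\left(\frac{1+\sqrt{(1-2zq)^2+4z\nu^2q(1-q)}}{2}\right).$$ **Theorem 2.** Let $\tfrac12\le\eta\le1$. The single-letter classical–quantum trade-off region of $\mathcal A$ is the union, over all $p,\nu\in[0,1]$, of the polyhedra of pairs $(C,Q)\in\mathbb R^2$ with $$Q\le \mathsf g(p,\eta,\nu)-\mathsf g(p,1-\eta,\nu),\qquad C+Q\le h_2(\eta p)-\mathsf g(p,1-\eta,\nu).$$ Moreover, it is achieved by the following ensembles: for all $p,\nu\in[0,1]$ the two matrices $$\rho^0=\begin{pmatrix}1-p&\nu\sqrt{p(1-p)}\\ \nu\sqrt{p(1-p)}&p\end{pmatrix},\qquad \rho^1=\begin{pmatrix}1-p&-\nu\sqrt{p(1-p)}\\ -\nu\sqrt{p(1-p)}&p\end{pmatrix}$$ are qubit density matrices, and every ensemble that consists, with probability $\tfrac12$ each, of purifications $|\phi^0\rangle,|\phi^1\rangle$ of $\rho^0,\rho^1$ satisfies $$I(A\rangle BX)=\mathsf g(p,\eta,\nu)-\mathsf g(p,1-\eta,\nu),\qquad I(X;B)+I(A\rangle BX)=h_2(\eta p)-\mathsf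 g(p,1-\eta,\nu).$$ -/

import Mathlib

open scoped Kronecker

noncomputable section

namespace CQTradeoff

/-- The binary Shannon entropy in bits. -/
def h2 (y : ℝ) : ℝ := -y * Real.logb 2 y - (1 - y) * Real.logb 2 (1 - y)

/-- `g(q, z, ν) = h₂((1 + √((1 - 2zq)² + 4zν²q(1 - q))) / 2)`. -/
def g (q z ν : ℝ) : ℝ :=
  h2 ((1 + Real.sqrt ((1 - 2 * z * q) ^ 2 + 4 * z * ν ^ 2 * q * (1 - q))) / 2)

open Classical in
/-- The von Neumann entropy `-Tr (ρ log₂ ρ)` in bits, computed from the eigenvalues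
(it is only ever applied to Hermitian matrices; the value `0` elsewhere is a dummy). -/
def entropy {n : Type*} [Fintype n] [DecidableEq n] (ρ : Matrix n n ℂ) : ℝ :=
  if h : ρ.IsHermitian then -∑ i, h.eigenvalues i * Real.logb 2 (h.eigenvalues i) else 0

/-- Partial trace over the first tensor factor. -/
def traceLeft {m n : Type*} [Fintype m] (M : Matrix (m × n) (m × n) ℂ) : Matrix n n ℂ :=
  Matrix.of fun i j => ∑ a, M (a, i) (a, j)

/-- Partial trace over the second tensor factor. -/
def traceRight {m n : Type*} [Fintype n] (M : Matrix (m × n) (m × n) ℂ) : Matrix m m ℂ :=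
  Matrix.of fun i j => ∑ b, M (i, b) (j, b)

/-- Partial trace over the middle one of three tensor factors. -/
def traceMiddle {l m n : Type*} [Fintype m] (M : Matrix (l × m × n) (l × m × n) ℂ) :
    Matrix (l × n) (l × n) ℂ :=
  Matrix.of fun i j => ∑ a, M (i.1, a, i.2) (j.1, a, j.2)

/-- The rank-one operator `|φ⟩⟨φ|`. -/
def ketBra {n : Type*} (φ : n → ℂ) : Matrix n n ℂ := Matrix.vecMulVec φ (star φ)

/-- `id_A ⊗ 𝒩`: the map `𝒩` acts on the second tensor factor. -/
def applyRight {A A' B : Type*} (𝒩 : Matrix A' A' ℂ →ₗ[ℂ] Matrix B B ℂ)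
    (M : Matrix (A × A') (A × A') ℂ) : Matrix (A × B) (A × B) ℂ :=
  Matrix.of fun i j => 𝒩 (Matrix.of fun s t => M (i.1, s) (j.1, t)) i.2 j.2

/-- The map `ρ ↦ ∑ⱼ Kⱼ ρ Kⱼ†`. -/
def krausMap {J A' B : Type*} [Fintype J] [Fintype A'] (K : J → Matrix B A' ℂ) :
    Matrix A' A' ℂ →ₗ[ℂ] Matrix B B ℂ where
  toFun ρ := ∑ j, K j * ρ * (K j).conjTranspose
  map_add' ρ σ := by simp [Matrix.mul_add, Matrix.add_mul, Finset.sum_add_distrib]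
  map_smul' c ρ := by simp [Finset.smul_sum]

/-- The qubit amplitude damping channel of transmissivity `η`. Index `0` is the state that the
channel leaves fixed, index `1` the state that decays into it. -/
def amplitudeDamping (η : ℝ) : Matrix (Fin 2) (Fin 2) ℂ →ₗ[ℂ] Matrix (Fin 2) (Fin 2) ℂ :=
  krausMap (J := Fin 2)
    ![!![1, 0; 0, (Real.sqrt η : ℂ)], !![0, (Real.sqrt (1 - η) : ℂ); 0, 0]]

/-- An ensemble `{p_X(x), |φˣ⟩_{AA'}}` of bipartite pure states. -/
structure Ensemble (X A A' : Type*) [Fintype X] [Fintype A] [Fintype A'] where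
  prob : X → ℝ
  prob_nonneg : ∀ x, 0 ≤ prob x
  prob_sum : ∑ x, prob x = 1
  φ : X → A × A' → ℂ
  φ_unit : ∀ x, ∑ i, ‖φ x i‖ ^ 2 = 1

namespace Ensemble

variable {X A A' B : Type*} [Fintype X] [Fintype A] [Fintype A'] [Fintype B]
  [DecidableEq X] [DecidableEq A] [DecidableEq B]

/-- The channel input `ρˣ_{A'}`, of which `φˣ` is a purification. -/
def inputState (e : Ensemble X A A') (x : X) : Matrix A' A' ℂ :=
  traceLeft (ketBra (e.φ x))

/-- The classical-quantum state
`ρ_{XAB} = ∑ₓ p_X(x) |x⟩⟨x|_X ⊗ 𝒩_{A' → B}(|φˣ⟩⟨φˣ|_{AA'})`. -/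
def cqState (e : Ensemble X A A') (𝒩 : Matrix A' A' ℂ →ₗ[ℂ] Matrix B B ℂ) :
    Matrix (X × A × B) (X × A × B) ℂ :=
  ∑ x, (e.prob x : ℂ) • (Matrix.single x x (1 : ℂ) ⊗ₖ applyRight 𝒩 (ketBra (e.φ x)))

/-- The coherent information `I(A⟩BX) = H(BX) - H(ABX)`. -/
def coherentInfo (e : Ensemble X A A') (𝒩 : Matrix A' A' ℂ →ₗ[ℂ] Matrix B B ℂ) : ℝ :=
  entropy (traceMiddle (e.cqState 𝒩)) - entropy (e.cqState 𝒩)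

/-- The Holevo information `I(X;B) = H(X) + H(B) - H(BX)`. -/
def holevoInfo (e : Ensemble X A A') (𝒩 : Matrix A' A' ℂ →ₗ[ℂ] Matrix B B ℂ) : ℝ :=
  entropy (traceRight (e.cqState 𝒩)) + entropy (traceLeft (traceLeft (e.cqState 𝒩)))
    - entropy (traceMiddle (e.cqState 𝒩))

end Ensemble

/-- The single-letter classical-quantum trade-off region of a channel: the rate pairs `(C, Q)`
with `Q ≤ I(A⟩BX)` and `C + Q ≤ I(X;B) + I(A⟩BX)` for some finite ensemble. -/
def tradeoffRegion {A' B : Type*} [Fintype A'] [Fintype B] [DecidableEq B]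
    (𝒩 : Matrix A' A' ℂ →ₗ[ℂ] Matrix B B ℂ) : Set (ℝ × ℝ) :=
  {r | ∃ (k d : ℕ) (e : Ensemble (Fin k) (Fin d) A'),
    r.2 ≤ e.coherentInfo 𝒩 ∧ r.1 + r.2 ≤ e.holevoInfo 𝒩 + e.coherentInfo 𝒩}

/-- The polyhedron of rate pairs `(C, Q)` with parameters `p, ν`. -/
def polyhedron (η p ν : ℝ) : Set (ℝ × ℝ) :=
  {r | r.2 ≤ g p η ν - g p (1 - η) ν ∧ r.1 + r.2 ≤ h2 (η * p) - g p (1 - η) ν}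

/-- The matrix with diagonal `(1 - p, p)` and off-diagonal entries `ν √(p (1 - p))`. -/
def qubitState (p ν : ℝ) : Matrix (Fin 2) (Fin 2) ℂ :=
  !![((1 - p : ℝ) : ℂ), ((ν * Real.sqrt (p * (1 - p)) : ℝ) : ℂ);
     ((ν * Real.sqrt (p * (1 - p)) : ℝ) : ℂ), (p : ℂ)]

/-- The ensemble consists of purifications of the two states with diagonal `(1 - p, p)` and
off-diagonal entries `±ν √(p (1 - p))`, taken with probability `1/2` each. -/
def IsSymmetricEnsemble {A : Type*} [Fintype A] (p ν : ℝ)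
    (e : Ensemble (Fin 2) A (Fin 2)) : Prop :=
  (∀ x, e.prob x = 1 / 2) ∧
    e.inputState 0 = qubitState p ν ∧ e.inputState 1 = qubitState p (-ν)

end CQTradeoff

end

/-! The complementary channel of the amplitude damping channel of transmissivity `η` is the one of
transmissivity `1 - η`, so both rates are combinations of averaged qubit entropies, and a qubit
entropy is a function `φ` of the determinant `D` alone. For `1/2 ≤ η < 1` the point is that the
output entropy is a concave function of the pair (population of the input, entropy of the
environment). Along lines this reduces to `φ` being concave with `-D φ''(D) / φ'(D)` nondecreasing
and at most `1/2`. Averaging over an ensemble is then dominated by a single pair `(p, ν)`: the mean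
population, and the `ν` that reproduces the mean entropy of the environment. The two states `±ν`
attain the bound because their off-diagonal entries cancel on average, which leaves the output
entropy `h₂(η p)`. -/

noncomputable section

namespace CQTradeoff

open Set Filter Topology

/-! ### Estimates for the inverse hyperbolic tangent -/

lemma le_of_hasDerivAt_le {f f' g g' : ℝ → ℝ} {a b x : ℝ} (ha : f a ≤ g a)
    (hf : ∀ y ∈ Ico a b, HasDerivAt f (f' y) y) (hg : ∀ y ∈ Ico a b, HasDerivAt g (g' y) y)
    (hfg : ∀ y ∈ Ico a b, f' y ≤ g' y) (hx : x ∈ Ico a b) : f x ≤ g x := by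
  have hsub : Icc a x ⊆ Ico a b := Icc_subset_Ico_right hx.2
  have hsub' : Ico a x ⊆ Ico a b := Ico_subset_Ico_right hx.2.le
  exact image_le_of_deriv_right_le_deriv_boundary
    (fun y hy => (hf y (hsub hy)).continuousAt.continuousWithinAt)
    (fun y hy => (hf y (hsub' hy)).hasDerivWithinAt) ha
    (fun y hy => (hg y (hsub hy)).continuousAt.continuousWithinAt)
    (fun y hy => (hg y (hsub' hy)).hasDerivWithinAt)
    (fun y hy => hfg y (hsub' hy)) (right_mem_Icc.2 hx.1)

lemma one_sub_sq_pos {r : ℝ} (hr : r ∈ Ioo (-1 : ℝ) 1) : 0 < 1 - r ^ 2 := by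
  nlinarith [hr.1, hr.2]

lemma hasDerivAt_artanh {r : ℝ} (hr : r ∈ Ioo (-1 : ℝ) 1) :
    HasDerivAt Real.artanh (1 / (1 - r ^ 2)) r := by
  have hadd : 1 + r ≠ 0 := by linarith [hr.1]
  have hsub : 1 - r ≠ 0 := by linarith [hr.2]
  have := (one_sub_sq_pos hr).ne'
  have hquot := ((hasDerivAt_id r).const_add 1).div ((hasDerivAt_id r).const_sub 1) hsub
  have hlog := (hquot.log (div_ne_zero hadd hsub)).const_mul (1 / 2)
  have heq : Real.artanh =ᶠ[𝓝 r] fun x => 1 / 2 * Real.log ((1 + x) / (1 - x)) := by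
    filter_upwards [Ioo_mem_nhds hr.1 hr.2] with x hx
    exact Real.artanh_eq_half_log (Ioo_subset_Icc_self hx)
  refine (hlog.congr_of_eventuallyEq heq).congr_deriv ?_
  simp only [id, Pi.div_apply]
  rw [show 1 - r ^ 2 = (1 + r) * (1 - r) by ring]
  field_simp
  ring

lemma Ico_zero_one_subset : Ico (0 : ℝ) 1 ⊆ Ioo (-1) 1 :=
  Ico_subset_Ioo_left (by norm_num)

lemma le_artanh {r : ℝ} (hr : r ∈ Ico (0 : ℝ) 1) : r ≤ Real.artanh r := by
  refine le_of_hasDerivAt_le (f := id) (by simp) (fun x _ => hasDerivAt_id x)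
    (fun x hx => hasDerivAt_artanh (Ico_zero_one_subset hx)) (fun x hx => ?_) hr
  rw [le_div_iff₀ (one_sub_sq_pos (Ico_zero_one_subset hx))]
  nlinarith [sq_nonneg x]

lemma artanh_le {r : ℝ} (hr : r ∈ Ico (0 : ℝ) 1) :
    Real.artanh r ≤ r * (3 - r ^ 2) / ((1 - r ^ 2) * (3 + r ^ 2)) := by
  have hsq (x : ℝ) : HasDerivAt (fun x : ℝ => x ^ 2) (2 * x) x := by simpa using hasDerivAt_pow 2 x
  have hpos : ∀ x ∈ Ico (0 : ℝ) 1, 0 < 1 - x ^ 2 := fun x hx =>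
    one_sub_sq_pos (Ico_zero_one_subset hx)
  refine le_of_hasDerivAt_le (by simp) (fun x hx => hasDerivAt_artanh (Ico_zero_one_subset hx))
    (fun x hx => ((hasDerivAt_id x).mul ((hsq x).const_sub 3)).div
      (((hsq x).const_sub 1).mul ((hsq x).const_add 3))
      (mul_pos (hpos x hx) (by positivity)).ne') (fun x hx => ?_) hr
  have h := hpos x hx
  simp only [id, Pi.mul_apply]
  rw [div_le_div_iff₀ h (by positivity)]
  have : 0 ≤ x ^ 4 * (1 - x ^ 2) * (9 + x ^ 2) := by positivity
  nlinarith [this]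

lemma artanh_sq_le {r : ℝ} (hr : r ∈ Ico (0 : ℝ) 1) :
    Real.artanh r ^ 2 ≤ (r ^ 2 / (1 - r ^ 2) + r * Real.artanh r) / 2 := by
  have hsq (x : ℝ) : HasDerivAt (fun x : ℝ => x ^ 2) (2 * x) x := by simpa using hasDerivAt_pow 2 x
  have hpos : ∀ x ∈ Ico (0 : ℝ) 1, 0 < 1 - x ^ 2 := fun x hx =>
    one_sub_sq_pos (Ico_zero_one_subset hx)
  have hL : ∀ x ∈ Ico (0 : ℝ) 1, HasDerivAt Real.artanh (1 / (1 - x ^ 2)) x := fun x hx =>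
    hasDerivAt_artanh (Ico_zero_one_subset hx)
  refine le_of_hasDerivAt_le (f := fun x => Real.artanh x ^ 2) (by simp)
    (fun x hx => (hL x hx).fun_pow 2)
    (fun x hx => (((hsq x).div ((hsq x).const_sub 1) (hpos x hx).ne').add
      ((hasDerivAt_id x).mul (hL x hx))).div_const 2) (fun x hx => ?_) hr
  have h := hpos x hx
  have hle := artanh_le hx
  rw [le_div_iff₀ (by positivity)] at hle
  rw [← sub_nonneg]
  have hdiff : (((2 * x * (1 - x ^ 2) - x ^ 2 * -(2 * x)) / (1 - x ^ 2) ^ 2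
      + (1 * Real.artanh x + id x * (1 / (1 - x ^ 2)))) / 2)
      - (2 : ℕ) * Real.artanh x ^ (2 - 1) * (1 / (1 - x ^ 2))
      = (x * (3 - x ^ 2) - Real.artanh x * ((1 - x ^ 2) * (3 + x ^ 2)))
        / (2 * (1 - x ^ 2) ^ 2) := by
    simp only [id]; field_simp; norm_num; ring
  rw [hdiff]
  exact div_nonneg (by linarith) (by positivity)

lemma one_sub_sq_mul_artanh_lt {r : ℝ} (hr : r ∈ Ioo (0 : ℝ) 1) :
    (1 - r ^ 2) * Real.artanh r < r := by
  have h0 := hr.1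
  have h := one_sub_sq_pos (Ico_zero_one_subset (Ioo_subset_Ico_self hr))
  have hle := artanh_le (Ioo_subset_Ico_self hr)
  calc (1 - r ^ 2) * Real.artanh r
      ≤ (1 - r ^ 2) * (r * (3 - r ^ 2) / ((1 - r ^ 2) * (3 + r ^ 2))) := by gcongr
    _ = r * (3 - r ^ 2) / (3 + r ^ 2) := by field_simp
    _ < r := by
      rw [div_lt_iff₀ (by positivity)]
      gcongr
      linarith [pow_pos h0 2]

/-- The elasticity `-D φ''(D) / φ'(D)` of the entropy `φ` of a qubit state as a function of its
determinant `D`, in terms of the length `r = √(1 - 4 D)` of the Bloch vector. -/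
def elasticity (r : ℝ) : ℝ := (r - (1 - r ^ 2) * Real.artanh r) / (2 * r ^ 2 * Real.artanh r)

lemma elasticity_pos {r : ℝ} (hr : r ∈ Ioo (0 : ℝ) 1) : 0 < elasticity r := by
  have := hr.1
  have := Real.artanh_pos hr
  exact div_pos (sub_pos.2 (one_sub_sq_mul_artanh_lt hr)) (by positivity)

lemma elasticity_le_half {r : ℝ} (hr : r ∈ Ioo (0 : ℝ) 1) : elasticity r ≤ 1 / 2 := by
  have := hr.1
  have := Real.artanh_pos hr
  rw [elasticity, div_le_div_iff₀ (by positivity) two_pos]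
  linarith [le_artanh (Ioo_subset_Ico_self hr)]

lemma antitoneOn_elasticity : AntitoneOn elasticity (Ioo 0 1) := by
  have hderiv : ∀ r ∈ Ioo (0 : ℝ) 1, HasDerivAt elasticity
      ((Real.artanh r ^ 2 - (r ^ 2 / (1 - r ^ 2) + r * Real.artanh r) / 2)
        / (r ^ 3 * Real.artanh r ^ 2)) r := by
    intro r hr
    have hr0 := hr.1
    have hmem := Ico_zero_one_subset (Ioo_subset_Ico_self hr)
    have hpos := Real.artanh_pos hr
    have hsub := one_sub_sq_pos hmem
    have hsq : HasDerivAt (fun r : ℝ => r ^ 2) (2 * r) r := by simpa using hasDerivAt_pow 2 r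
    have hL := hasDerivAt_artanh hmem
    refine (((hasDerivAt_id r).sub ((hsq.const_sub 1).mul hL)).div
      ((hsq.const_mul 2).mul hL) (by simp only [Pi.mul_apply]; positivity)).congr_deriv ?_
    simp only [id, Pi.mul_apply, Pi.sub_apply]
    field_simp
    ring
  refine antitoneOn_of_hasDerivWithinAt_nonpos (convex_Ioo 0 1)
    (fun r hr => (hderiv r hr).continuousAt.continuousWithinAt)
    (fun r hr => (hderiv r (interior_subset hr)).hasDerivWithinAt) fun r hr => ?_
  rw [interior_Ioo] at hr
  have := hr.1
  exact div_nonpos_of_nonpos_of_nonneg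
    (sub_nonpos.2 (artanh_sq_le (Ioo_subset_Ico_self hr))) (by positivity)

/-! ### The entropy of a qubit state as a function of its determinant -/

/-- The entropy, in nats, of a qubit state of determinant `D`, whose eigenvalues are
`(1 ± √(1 - 4 D)) / 2`. -/
def detEntropy (D : ℝ) : ℝ := Real.binEntropy ((1 + √(1 - 4 * D)) / 2)

/-- The derivative of `detEntropy` on `(0, 1/4)`. -/
def detEntropyDeriv (D : ℝ) : ℝ := 2 * Real.artanh √(1 - 4 * D) / √(1 - 4 * D)

/-- The elasticity `-D φ''(D) / φ'(D)` of `φ = detEntropy`. -/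
def detElasticity (D : ℝ) : ℝ := elasticity √(1 - 4 * D)

lemma sqrt_one_sub_four_mul_mem {D : ℝ} (hD : D ∈ Ioo (0 : ℝ) (1 / 4)) :
    √(1 - 4 * D) ∈ Ioo (0 : ℝ) 1 := by
  refine ⟨Real.sqrt_pos.2 (by linarith [hD.2]), ?_⟩
  rw [Real.sqrt_lt' one_pos]
  linarith [hD.1]

lemma detEntropyDeriv_pos {D : ℝ} (hD : D ∈ Ioo (0 : ℝ) (1 / 4)) : 0 < detEntropyDeriv D := by
  have hr := sqrt_one_sub_four_mul_mem hD
  exact div_pos (mul_pos two_pos (Real.artanh_pos hr)) hr.1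

lemma detElasticity_pos {D : ℝ} (hD : D ∈ Ioo (0 : ℝ) (1 / 4)) : 0 < detElasticity D :=
  elasticity_pos (sqrt_one_sub_four_mul_mem hD)

lemma detElasticity_le_half {D : ℝ} (hD : D ∈ Ioo (0 : ℝ) (1 / 4)) : detElasticity D ≤ 1 / 2 :=
  elasticity_le_half (sqrt_one_sub_four_mul_mem hD)

lemma monotoneOn_detElasticity : MonotoneOn detElasticity (Ioo 0 (1 / 4)) := fun _ hx _ hy hxy =>
  antitoneOn_elasticity (sqrt_one_sub_four_mul_mem hy) (sqrt_one_sub_four_mul_mem hx)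
    (Real.sqrt_le_sqrt (by linarith))

lemma hasDerivAt_sqrt_one_sub_four_mul {D : ℝ} (hD : D < 1 / 4) :
    HasDerivAt (fun D => √(1 - 4 * D)) (-2 / √(1 - 4 * D)) D := by
  have hpos : 0 < 1 - 4 * D := by linarith
  have := Real.sqrt_pos.2 hpos
  refine ((((hasDerivAt_id D).const_mul 4).const_sub 1).sqrt hpos.ne').congr_deriv ?_
  simp only [id]
  field_simp
  norm_num

lemma continuous_detEntropy : Continuous detEntropy := by
  unfold detEntropy; fun_prop

lemma hasDerivAt_detEntropy {D : ℝ} (hD : D ∈ Ioo (0 : ℝ) (1 / 4)) :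
    HasDerivAt detEntropy (detEntropyDeriv D) D := by
  have hr := sqrt_one_sub_four_mul_mem hD
  have hb := Real.hasDerivAt_binEntropy (p := (1 + √(1 - 4 * D)) / 2)
    (by linarith [hr.1]) (by linarith [hr.2])
  refine (hb.comp D (((hasDerivAt_sqrt_one_sub_four_mul hD.2).const_add 1).div_const 2)).congr_deriv
    ?_
  rw [detEntropyDeriv, Real.artanh_eq_half_log (by constructor <;> linarith [hr.1, hr.2])]
  have h0 := hr.1
  have h1 : 0 < 1 - √(1 - 4 * D) := sub_pos.2 hr.2
  generalize √(1 - 4 * D) = r at *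
  rw [show 1 - (1 + r) / 2 = (1 - r) / 2 by ring, Real.log_div h1.ne' two_ne_zero,
    Real.log_div (by positivity) two_ne_zero, Real.log_div (by positivity) h1.ne']
  field_simp
  ring

lemma hasDerivAt_detEntropyDeriv {D : ℝ} (hD : D ∈ Ioo (0 : ℝ) (1 / 4)) :
    HasDerivAt detEntropyDeriv (-(detElasticity D / D * detEntropyDeriv D)) D := by
  have hr := sqrt_one_sub_four_mul_mem hD
  have hmem := Ico_zero_one_subset (Ioo_subset_Ico_self hr)
  refine ((((hasDerivAt_artanh hmem).const_mul 2).div (hasDerivAt_id _) hr.1.ne').comp D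
    (hasDerivAt_sqrt_one_sub_four_mul hD.2)).congr_deriv ?_
  have hL := Real.artanh_pos hr
  have hsub := one_sub_sq_pos hmem
  have hDr : D = (1 - √(1 - 4 * D) ^ 2) / 4 := by
    rw [Real.sq_sqrt (by linarith [hD.2])]; ring
  simp only [id, detEntropyDeriv, detElasticity, elasticity]
  generalize √(1 - 4 * D) = r at *
  subst hDr
  have := hr.1
  field_simp
  ring

lemma strictMonoOn_detEntropy : StrictMonoOn detEntropy (Icc 0 (1 / 4)) := by
  refine strictMonoOn_of_deriv_pos (convex_Icc _ _) continuous_detEntropy.continuousOn ?_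
  intro D hD
  rw [interior_Icc] at hD
  rw [(hasDerivAt_detEntropy hD).deriv]
  exact detEntropyDeriv_pos hD

lemma detEntropy_mul_one_sub (y : ℝ) : detEntropy (y * (1 - y)) = Real.binEntropy y := by
  rw [detEntropy, show 1 - 4 * (y * (1 - y)) = (1 - 2 * y) ^ 2 by ring, Real.sqrt_sq_eq_abs]
  rcases abs_cases (1 - 2 * y) with ⟨h, -⟩ | ⟨h, -⟩
  · rw [h, ← Real.binEntropy_one_sub y]; ring_nf
  · rw [h]; ring_nf

lemma detEntropy_zero : detEntropy 0 = 0 := by simp [detEntropy]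

lemma detEntropy_one_fourth : detEntropy (1 / 4) = Real.log 2 := by
  rw [← Real.binEntropy_two_inv, ← detEntropy_mul_one_sub]; norm_num

lemma mul_one_sub_mem_Icc {y : ℝ} (hy : y ∈ Icc (0 : ℝ) 1) :
    y * (1 - y) ∈ Icc (0 : ℝ) (1 / 4) :=
  ⟨mul_nonneg hy.1 (sub_nonneg.2 hy.2), by nlinarith [sq_nonneg (1 - 2 * y)]⟩

lemma convexOn_detEntropy_mul_sq {θ : ℝ} (hθ : θ ∈ Icc (0 : ℝ) (1 / 4)) :
    ConvexOn ℝ (Icc 0 1) fun p => detEntropy (θ * p ^ 2) := by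
  rcases hθ.1.eq_or_lt with rfl | hθ0
  · simpa using convexOn_const _ (convex_Icc (0 : ℝ) 1)
  have hmem : ∀ p ∈ interior (Icc (0 : ℝ) 1), θ * p ^ 2 ∈ Ioo (0 : ℝ) (1 / 4) := by
    intro p hp
    rw [interior_Icc] at hp
    have := hp.1
    exact ⟨by positivity, by nlinarith [hp.2, hθ.2]⟩
  have hsq : ∀ p : ℝ, HasDerivAt (fun r : ℝ => θ * r ^ 2) (θ * (2 * p)) p := fun p => by
    simpa using (hasDerivAt_pow 2 p).const_mul θ
  refine convexOn_of_hasDerivWithinAt2_nonneg (convex_Icc _ _)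
    (continuous_detEntropy.comp (by fun_prop)).continuousOn
    (f' := fun p => detEntropyDeriv (θ * p ^ 2) * (θ * (2 * p)))
    (f'' := fun p => 2 * θ * detEntropyDeriv (θ * p ^ 2) * (1 - 2 * detElasticity (θ * p ^ 2)))
    (fun p hp => ?_) (fun p hp => ?_) (fun p hp => ?_)
  · exact ((hasDerivAt_detEntropy (hmem p hp)).comp p (hsq p)).hasDerivWithinAt
  · refine ((((hasDerivAt_detEntropyDeriv (hmem p hp)).comp p (hsq p)).mul
      (((hasDerivAt_id p).const_mul 2).const_mul θ)).congr_deriv ?_).hasDerivWithinAt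
    have hp0 : p ≠ 0 := by rintro rfl; simpa using (hmem 0 hp).1
    simp only [Function.comp_apply, id]
    field_simp
    ring
  · have := detEntropyDeriv_pos (hmem p hp)
    exact mul_nonneg (by positivity) (by linarith [detElasticity_le_half (hmem p hp)])

/-! ### The inverse of the entropy -/

/-- The determinant of a qubit state as a function of its entropy: the inverse of
`detEntropy : [0, 1/4] → [0, log 2]`. -/
def invDetEntropy : ℝ → ℝ := Function.invFunOn detEntropy (Icc 0 (1 / 4))

lemma surjOn_detEntropy : SurjOn detEntropy (Icc 0 (1 / 4)) (Icc 0 (Real.log 2)) := by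
  have h := intermediate_value_Icc (a := (0 : ℝ)) (b := 1 / 4) (by norm_num)
    continuous_detEntropy.continuousOn
  rwa [detEntropy_zero, detEntropy_one_fourth] at h

lemma invDetEntropy_mem {u : ℝ} (hu : u ∈ Icc 0 (Real.log 2)) :
    invDetEntropy u ∈ Icc (0 : ℝ) (1 / 4) :=
  Function.invFunOn_mem (surjOn_detEntropy hu)

lemma detEntropy_invDetEntropy {u : ℝ} (hu : u ∈ Icc 0 (Real.log 2)) :
    detEntropy (invDetEntropy u) = u :=
  Function.invFunOn_eq (surjOn_detEntropy hu)

lemma invDetEntropy_detEntropy {D : ℝ} (hD : D ∈ Icc (0 : ℝ) (1 / 4)) :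
    invDetEntropy (detEntropy D) = D :=
  strictMonoOn_detEntropy.injOn.leftInvOn_invFunOn hD

lemma detEntropy_mem_Icc {D : ℝ} (hD : D ∈ Icc (0 : ℝ) (1 / 4)) :
    detEntropy D ∈ Icc 0 (Real.log 2) := by
  have hmono := strictMonoOn_detEntropy.monotoneOn
  constructor
  · rw [← detEntropy_zero]; exact hmono (left_mem_Icc.2 (by norm_num)) hD hD.1
  · rw [← detEntropy_one_fourth]; exact hmono hD (right_mem_Icc.2 (by norm_num)) hD.2

lemma strictMonoOn_invDetEntropy : StrictMonoOn invDetEntropy (Icc 0 (Real.log 2)) := by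
  intro u hu w hw huw
  rw [← strictMonoOn_detEntropy.lt_iff_lt (invDetEntropy_mem hu) (invDetEntropy_mem hw)]
  rwa [detEntropy_invDetEntropy hu, detEntropy_invDetEntropy hw]

lemma surjOn_invDetEntropy : SurjOn invDetEntropy (Icc 0 (Real.log 2)) (Icc 0 (1 / 4)) :=
  fun D hD => ⟨detEntropy D, detEntropy_mem_Icc hD, invDetEntropy_detEntropy hD⟩

lemma image_invDetEntropy : invDetEntropy '' Icc 0 (Real.log 2) = Icc 0 (1 / 4) :=
  Subset.antisymm (image_subset_iff.2 fun _ => invDetEntropy_mem) surjOn_invDetEntropy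

lemma continuousOn_invDetEntropy : ContinuousOn invDetEntropy (Icc 0 (Real.log 2)) := by
  have : OrdConnected (invDetEntropy '' Icc 0 (Real.log 2)) := by
    rw [image_invDetEntropy]; exact ordConnected_Icc
  exact continuousOn_iff_continuous_domRestrict.2 (continuous_subtype_val.comp
    (strictMonoOn_invDetEntropy.orderIso invDetEntropy _).continuous)

lemma invDetEntropy_mem_Ioo {u : ℝ} (hu : u ∈ Ioo 0 (Real.log 2)) :
    invDetEntropy u ∈ Ioo (0 : ℝ) (1 / 4) := by
  have hmem := Ioo_subset_Icc_self hu
  have heq := detEntropy_invDetEntropy hmem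
  obtain ⟨h0, h1⟩ := invDetEntropy_mem hmem
  refine ⟨h0.lt_of_ne ?_, h1.lt_of_ne ?_⟩ <;> intro h
  · rw [← h, detEntropy_zero] at heq; exact hu.1.ne heq
  · rw [h, detEntropy_one_fourth] at heq; exact hu.2.ne' heq

lemma hasDerivAt_invDetEntropy {u : ℝ} (hu : u ∈ Ioo 0 (Real.log 2)) :
    HasDerivAt invDetEntropy (detEntropyDeriv (invDetEntropy u))⁻¹ u := by
  have hD := invDetEntropy_mem_Ioo hu
  refine (hasDerivAt_detEntropy hD).of_local_left_inverse
    (continuousOn_invDetEntropy.continuousAt (Icc_mem_nhds hu.1 hu.2))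
    (detEntropyDeriv_pos hD).ne' ?_
  filter_upwards [Icc_mem_nhds hu.1 hu.2] with w hw using detEntropy_invDetEntropy hw

/-! ### Concavity of the output entropy in the population and the environment entropy -/

/- Cauchy-Schwarz for `√k x = 1 · √k (x - 2 b p y) + √(2 b k) p · √(2 b) y`. -/
lemma mul_sq_le_one_add_mul {k b p x y : ℝ} (hb : 0 ≤ b) :
    k * x ^ 2 ≤ (1 + 2 * b * p ^ 2 * k) * (k * (x - 2 * b * p * y) ^ 2 + 2 * b * y ^ 2) := by
  have : 0 ≤ 2 * b * (y - k * (x - 2 * b * p * y) * p) ^ 2 := by positivity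
  linarith

lemma mul_detElasticity_le {D v a b p ω y : ℝ} (hD : 0 < D) (hDv : D ≤ v) (hv : v < 1 / 4)
    (ha : 0 ≤ a) (hb : 0 ≤ b) (hvp : v = a * D - b * p ^ 2) :
    a * (detElasticity D / D * ω ^ 2)
      ≤ detElasticity v / v * (a * ω - 2 * b * p * y) ^ 2 + 2 * b * y ^ 2 := by
  have hDmem : D ∈ Ioo (0 : ℝ) (1 / 4) := ⟨hD, hDv.trans_lt hv⟩
  have hvmem : v ∈ Ioo (0 : ℝ) (1 / 4) := ⟨hD.trans_le hDv, hv⟩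
  have hv0 := hvmem.1
  have hmono := monotoneOn_detElasticity hDmem hvmem hDv
  have hhalf := detElasticity_le_half hDmem
  have hpos := detElasticity_pos hvmem
  obtain ⟨k, hk⟩ : ∃ k, k = detElasticity v / v := ⟨_, rfl⟩
  rw [← hk]
  have hk0 : 0 < k := hk ▸ div_pos hpos hv0
  have hkv : k * v = detElasticity v := by rw [hk]; field_simp
  have hslope : detElasticity D / D * (1 + 2 * b * p ^ 2 * k) ≤ a * k := by
    rw [div_mul_eq_mul_div, div_le_iff₀ hD]
    calc detElasticity D * (1 + 2 * b * p ^ 2 * k)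
        = detElasticity D + 2 * detElasticity D * (b * p ^ 2 * k) := by ring
      _ ≤ k * v + 1 * (b * p ^ 2 * k) := by gcongr <;> linarith
      _ = a * k * D := by rw [hvp]; ring
  refine le_of_mul_le_mul_left ?_ (by positivity : 0 < 1 + 2 * b * p ^ 2 * k)
  calc (1 + 2 * b * p ^ 2 * k) * (a * (detElasticity D / D * ω ^ 2))
      = detElasticity D / D * (1 + 2 * b * p ^ 2 * k) * (a * ω ^ 2) := by ring
    _ ≤ a * k * (a * ω ^ 2) := by gcongr
    _ = k * (a * ω) ^ 2 := by ring
    _ ≤ _ := mul_sq_le_one_add_mul hb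

lemma hasDerivAt_const_add_mul_const (c c' t : ℝ) : HasDerivAt (fun t => c + t * c') c' t := by
  simpa using ((hasDerivAt_id t).mul_const c').const_add c

lemma hasDerivAt_invDetEntropy_line {u₀ u' t : ℝ} (hu : u₀ + t * u' ∈ Ioo 0 (Real.log 2)) :
    HasDerivAt (fun t => invDetEntropy (u₀ + t * u'))
      (u' / detEntropyDeriv (invDetEntropy (u₀ + t * u'))) t :=
  ((hasDerivAt_invDetEntropy hu).comp t (hasDerivAt_const_add_mul_const u₀ u' t)).congr_deriv
    (inv_mul_eq_div _ _)

lemma hasDerivAt_div_detEntropyDeriv {D : ℝ → ℝ} {c t : ℝ} (hmem : D t ∈ Ioo (0 : ℝ) (1 / 4))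
    (hD : HasDerivAt D (c / detEntropyDeriv (D t)) t) :
    HasDerivAt (fun t => c / detEntropyDeriv (D t))
      (detElasticity (D t) / D t * (c / detEntropyDeriv (D t)) ^ 2) t := by
  have hne := (detEntropyDeriv_pos hmem).ne'
  refine (((hasDerivAt_detEntropyDeriv hmem).comp t hD).fun_inv hne |>.const_mul c).congr_deriv ?_
  simp only [Function.comp_apply]
  field_simp

lemma concaveOn_detEntropy_invDetEntropy_line {a b p₀ p' u₀ u' : ℝ} (ha : 0 ≤ a) (hb : 0 ≤ b)
    (hu : ∀ t ∈ Icc (0 : ℝ) 1, u₀ + t * u' ∈ Icc 0 (Real.log 2))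
    (hu' : ∀ t ∈ Ioo (0 : ℝ) 1, u₀ + t * u' ∈ Ioo 0 (Real.log 2))
    (hv : ∀ t ∈ Ioo (0 : ℝ) 1,
      a * invDetEntropy (u₀ + t * u') - b * (p₀ + t * p') ^ 2 ∈
        Ico (invDetEntropy (u₀ + t * u')) (1 / 4)) :
    ConcaveOn ℝ (Icc 0 1)
      fun t => detEntropy (a * invDetEntropy (u₀ + t * u') - b * (p₀ + t * p') ^ 2) := by
  let D : ℝ → ℝ := fun t => invDetEntropy (u₀ + t * u')
  let D' : ℝ → ℝ := fun t => u' / detEntropyDeriv (D t)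
  let v : ℝ → ℝ := fun t => a * D t - b * (p₀ + t * p') ^ 2
  let v' : ℝ → ℝ := fun t => a * D' t - 2 * b * (p₀ + t * p') * p'
  have hD : ∀ t ∈ Ioo (0 : ℝ) 1, HasDerivAt D (D' t) t := fun t ht =>
    hasDerivAt_invDetEntropy_line (hu' t ht)
  have hDmem : ∀ t ∈ Ioo (0 : ℝ) 1, D t ∈ Ioo (0 : ℝ) (1 / 4) := fun t ht =>
    invDetEntropy_mem_Ioo (hu' t ht)
  have hvmem : ∀ t ∈ Ioo (0 : ℝ) 1, v t ∈ Ioo (0 : ℝ) (1 / 4) := fun t ht =>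
    ⟨(hDmem t ht).1.trans_le (hv t ht).1, (hv t ht).2⟩
  have hline := hasDerivAt_const_add_mul_const p₀ p'
  have hderiv : ∀ t ∈ Ioo (0 : ℝ) 1, HasDerivAt v (v' t) t := fun t ht =>
    (((hD t ht).const_mul a).sub (((hline t).fun_pow 2).const_mul b)).congr_deriv
      (by simp only [v']; norm_num; ring)
  have hcont : ContinuousOn v (Icc 0 1) :=
    ((continuousOn_invDetEntropy.comp (by fun_prop) hu).const_mul a).sub (by fun_prop)
  refine concaveOn_of_hasDerivWithinAt2_nonpos (convex_Icc _ _)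
    (continuous_detEntropy.comp_continuousOn hcont)
    (f' := fun t => detEntropyDeriv (v t) * v' t)
    (f'' := fun t => detEntropyDeriv (v t) * (a * (detElasticity (D t) / D t * D' t ^ 2)
      - (detElasticity (v t) / v t * v' t ^ 2 + 2 * b * p' ^ 2))) ?_ ?_ ?_
  all_goals
    rw [interior_Icc]
    intro t ht
  · exact ((hasDerivAt_detEntropy (hvmem t ht)).comp t (hderiv t ht)).hasDerivWithinAt
  · have hv'' : HasDerivAt v' (a * (detElasticity (D t) / D t * D' t ^ 2) - 2 * b * p' ^ 2) t :=
      (((hasDerivAt_div_detEntropyDeriv (hDmem t ht) (hD t ht)).const_mul a).sub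
        (((hline t).const_mul (2 * b)).mul_const p')).congr_deriv (by ring)
    refine ((((hasDerivAt_detEntropyDeriv (hvmem t ht)).comp t (hderiv t ht)).mul
      hv'').congr_deriv ?_).hasDerivWithinAt
    simp only [Function.comp_apply]
    ring
  · exact mul_nonpos_of_nonneg_of_nonpos (detEntropyDeriv_pos (hvmem t ht)).le
      (sub_nonpos.2 (mul_detElasticity_le (hDmem t ht).1 (hv t ht).1 (hv t ht).2 ha hb rfl))

lemma concaveOn_of_lineMap {E : Type*} [AddCommGroup E] [Module ℝ E] {s : Set E} {f : E → ℝ}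
    (hs : Convex ℝ s) (hf : ∀ x ∈ s, ∀ y ∈ s, x ≠ y →
      ConcaveOn ℝ (Icc 0 1) fun t : ℝ => f (AffineMap.lineMap x y t)) : ConcaveOn ℝ s f := by
  refine ⟨hs, fun x hx y hy a b ha hb hab => ?_⟩
  rcases eq_or_ne x y with rfl | hxy
  · rw [← add_smul, ← add_smul, hab, one_smul, one_smul]
  have h := (hf x hx y hy hxy).2 (left_mem_Icc.2 zero_le_one) (right_mem_Icc.2 zero_le_one)
    ha hb hab
  obtain rfl : a = 1 - b := by linarith
  simpa [AffineMap.lineMap_apply_module] using h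

lemma lineMap_snd_lt_of_strictConcaveOn {E : Type*} [AddCommGroup E] [Module ℝ E] {s : Set E}
    {f : E → ℝ} (hf : StrictConcaveOn ℝ s f) {x y : E × ℝ} (hx : x.1 ∈ s ∧ x.2 ≤ f x.1)
    (hy : y.1 ∈ s ∧ y.2 ≤ f y.1) (hxy : x ≠ y) {t : ℝ} (ht : t ∈ Ioo (0 : ℝ) 1) :
    (AffineMap.lineMap x y t).2 < f (AffineMap.lineMap x y t).1 := by
  have ht' : 0 < 1 - t := sub_pos.2 ht.2
  have ht0 := ht.1
  simp only [AffineMap.lineMap_apply_module, Prod.snd_add, Prod.smul_snd, Prod.fst_add,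
    Prod.smul_fst]
  by_cases h : x.1 = y.1
  · have hne : x.2 ≠ y.2 := fun h' => hxy (Prod.ext h h')
    rw [← h, ← add_smul, sub_add_cancel, one_smul]
    rw [← h] at hy
    simp only [smul_eq_mul]
    rcases hne.lt_or_gt with h' | h' <;> nlinarith [hx.2, hy.2]
  · calc (1 - t) • x.2 + t • y.2 ≤ (1 - t) • f x.1 + t • f y.1 := by
          gcongr
          exacts [hx.2, hy.2]
      _ < _ := hf.2 hx.1 hy.1 h ht' ht0 (by ring)

/-- The determinant of the output of the amplitude damping channel of transmissivity `z` for the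
input of population `p` whose off-diagonal entry has modulus `ν √(p (1 - p))`. -/
def outDet (z p ν : ℝ) : ℝ := z * p * (1 - z * p) - z * ν ^ 2 * (p * (1 - p))

lemma outDet_zero (z p : ℝ) : outDet z p 0 = z * p * (1 - z * p) := by
  simp [outDet]

lemma outDet_one (z p : ℝ) : outDet z p 1 = z * (1 - z) * p ^ 2 := by
  rw [outDet]; ring

lemma continuous_outDet (z p : ℝ) : Continuous (outDet z p) := by
  unfold outDet; fun_prop

lemma antitoneOn_outDet {z p : ℝ} (hz : 0 ≤ z) (hp : p ∈ Icc (0 : ℝ) 1) :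
    AntitoneOn (outDet z p) (Ici 0) := by
  intro ν hν μ _ hνμ
  have := mul_one_sub_mem_Icc hp
  rw [mem_Ici] at hν
  unfold outDet
  gcongr
  exact this.1

lemma outDet_mem {z p ν : ℝ} (hz : z ∈ Icc (0 : ℝ) 1) (hp : p ∈ Icc (0 : ℝ) 1)
    (hν : ν ∈ Icc (0 : ℝ) 1) :
    outDet z p ν ∈ Icc (z * (1 - z) * p ^ 2) (z * p * (1 - z * p)) := by
  rw [← outDet_one, ← outDet_zero]
  exact ⟨antitoneOn_outDet hz.1 hp hν.1 (zero_le_one' ℝ) hν.2,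
    antitoneOn_outDet hz.1 hp (mem_Ici.2 le_rfl) hν.1 hν.1⟩

lemma Icc_outDet_subset {z p : ℝ} (hz : z ∈ Icc (0 : ℝ) 1) (hp : p ∈ Icc (0 : ℝ) 1) :
    Icc (z * (1 - z) * p ^ 2) (z * p * (1 - z * p)) ⊆ Icc 0 (1 / 4) :=
  Icc_subset_Icc (mul_nonneg (mul_nonneg hz.1 (sub_nonneg.2 hz.2)) (sq_nonneg p))
    (mul_one_sub_mem_Icc ⟨mul_nonneg hz.1 hp.1, mul_le_one₀ hz.2 hp.1 hp.2⟩).2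

lemma outDet_mem_Icc {z p ν : ℝ} (hz : z ∈ Icc (0 : ℝ) 1) (hp : p ∈ Icc (0 : ℝ) 1)
    (hν : ν ∈ Icc (0 : ℝ) 1) : outDet z p ν ∈ Icc (0 : ℝ) (1 / 4) :=
  Icc_outDet_subset hz hp (outDet_mem hz hp hν)

lemma outDet_one_sub {z : ℝ} (hz : z ≠ 0) (p ν : ℝ) :
    outDet (1 - z) p ν = (1 - z) / z * outDet z p ν - (1 - z) * (1 - 2 * z) * p ^ 2 := by
  rw [outDet, outDet]
  field_simp
  ring

/-- The pairs of a population `p` and an entropy `u` such that the amplitude damping channel of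
transmissivity `z` has output entropy `u` for some input of population `p`. -/
def entropyRegion (z : ℝ) : Set (ℝ × ℝ) :=
  {q | q.1 ∈ Icc 0 1 ∧
    q.2 ∈ Icc (detEntropy (z * (1 - z) * q.1 ^ 2)) (Real.binEntropy (z * q.1))}

/-- The output entropy of the amplitude damping channel of transmissivity `1 - z`, as a function of
the population of the input and of its output entropy under the complementary channel, which
is the amplitude damping channel of transmissivity `z`. -/
def complementEntropy (z : ℝ) (q : ℝ × ℝ) : ℝ :=
  detEntropy ((1 - z) / z * invDetEntropy q.2 - (1 - z) * (1 - 2 * z) * q.1 ^ 2)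

lemma mem_entropyRegion {z p ν : ℝ} (hz : z ∈ Icc (0 : ℝ) 1) (hp : p ∈ Icc (0 : ℝ) 1)
    (hν : ν ∈ Icc (0 : ℝ) 1) : (p, detEntropy (outDet z p ν)) ∈ entropyRegion z := by
  have hmem := outDet_mem hz hp hν
  have hsub := Icc_outDet_subset hz hp
  have hmono := strictMonoOn_detEntropy.monotoneOn
  have hle := hmem.1.trans hmem.2
  refine ⟨hp, hmono (hsub (left_mem_Icc.2 hle)) (hsub hmem) hmem.1, ?_⟩
  rw [← detEntropy_mul_one_sub]
  exact hmono (hsub hmem) (hsub (right_mem_Icc.2 hle)) hmem.2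

lemma exists_detEntropy_outDet_eq {z p u : ℝ} (hq : (p, u) ∈ entropyRegion z) :
    ∃ ν ∈ Icc (0 : ℝ) 1, detEntropy (outDet z p ν) = u := by
  refine intermediate_value_Icc' zero_le_one
    (continuous_detEntropy.comp (continuous_outDet z p)).continuousOn ?_
  simpa only [Function.comp_apply, outDet_one, outDet_zero, detEntropy_mul_one_sub] using hq.2

lemma complementEntropy_apply {z p ν : ℝ} (hz : z ∈ Ioc (0 : ℝ) 1) (hp : p ∈ Icc (0 : ℝ) 1)
    (hν : ν ∈ Icc (0 : ℝ) 1) :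
    complementEntropy z (p, detEntropy (outDet z p ν)) = detEntropy (outDet (1 - z) p ν) := by
  have hz' := Ioc_subset_Icc_self hz
  rw [complementEntropy, invDetEntropy_detEntropy (outDet_mem_Icc hz' hp hν),
    outDet_one_sub hz.1.ne']

lemma strictConcaveOn_binEntropy_mul {z : ℝ} (hz : z ∈ Ioc (0 : ℝ) 1) :
    StrictConcaveOn ℝ (Icc 0 1) fun p => Real.binEntropy (z * p) := by
  have hmem : ∀ p ∈ Icc (0 : ℝ) 1, z * p ∈ Icc (0 : ℝ) 1 := fun p hp =>
    ⟨mul_nonneg hz.1.le hp.1, mul_le_one₀ hz.2 hp.1 hp.2⟩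
  refine ⟨convex_Icc _ _, fun x hx y hy hxy a b ha hb hab => ?_⟩
  have h := Real.strictConcave_binEntropy.2 (hmem x hx) (hmem y hy)
    (fun h => hxy (mul_left_cancel₀ hz.1.ne' h)) ha hb hab
  simp only [smul_eq_mul] at h ⊢
  rwa [show z * (a * x + b * y) = a * (z * x) + b * (z * y) by ring]

lemma convex_entropyRegion {z : ℝ} (hz : z ∈ Ioc (0 : ℝ) 1) : Convex ℝ (entropyRegion z) := by
  have hθ := mul_one_sub_mem_Icc (Ioc_subset_Icc_self hz)
  have h := (convexOn_detEntropy_mul_sq hθ).convex_epigraph.inter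
    (strictConcaveOn_binEntropy_mul hz).concaveOn.convex_hypograph
  convert h using 1
  ext q
  simp only [entropyRegion, mem_ofPred_eq, mem_inter_iff, mem_Icc]
  tauto

lemma entropyRegion_snd_mem {z : ℝ} {q : ℝ × ℝ} (hz : z ∈ Icc (0 : ℝ) 1)
    (hq : q ∈ entropyRegion z) : q.2 ∈ Icc 0 (Real.log 2) := by
  obtain ⟨ν, hν, h⟩ := exists_detEntropy_outDet_eq hq
  exact h ▸ detEntropy_mem_Icc (outDet_mem_Icc hz hq.1 hν)

lemma snd_pos_of_mem_entropyRegion {z p u : ℝ} (hz : z ∈ Ioo (0 : ℝ) 1)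
    (hq : (p, u) ∈ entropyRegion z) (hp : 0 < p) : 0 < u := by
  obtain ⟨ν, hν, rfl⟩ := exists_detEntropy_outDet_eq hq
  have hz1 := Ioo_subset_Icc_self hz
  have hD := outDet_mem hz1 hq.1 hν
  have hpos : 0 < z * (1 - z) * p ^ 2 :=
    mul_pos (mul_pos hz.1 (sub_pos.2 hz.2)) (pow_pos hp 2)
  rw [← detEntropy_zero]
  exact strictMonoOn_detEntropy (left_mem_Icc.2 (by norm_num)) (Icc_outDet_subset hz1 hq.1 hD)
    (hpos.trans_le hD.1)

lemma lineMap_fst_pos_of_mem_entropyRegion {z : ℝ} {x y : ℝ × ℝ} (hx : x ∈ entropyRegion z)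
    (hy : y ∈ entropyRegion z) (hxy : x ≠ y) {t : ℝ} (ht : t ∈ Ioo (0 : ℝ) 1) :
    0 < (AffineMap.lineMap x y t).1 := by
  have hzero : ∀ q ∈ entropyRegion z, q.1 = 0 → q = 0 := fun q hq h => by
    have h2 := hq.2
    rw [h] at h2
    norm_num [detEntropy_zero] at h2
    exact Prod.ext h h2
  have ht0 := ht.1
  have ht1 : 0 < 1 - t := sub_pos.2 ht.2
  have hx1 := hx.1.1
  have hy1 := hy.1.1
  simp only [AffineMap.lineMap_apply_module, Prod.fst_add, Prod.smul_fst, smul_eq_mul]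
  rcases hx1.eq_or_lt with h | h
  · rcases hy1.eq_or_lt with h' | h'
    · exact absurd ((hzero x hx h.symm).trans (hzero y hy h'.symm).symm) hxy
    · positivity
  · positivity

lemma complement_det_mem_Ico {z p u : ℝ} (hz : z ∈ Ioc (0 : ℝ) (1 / 2)) (hp : p ∈ Icc (0 : ℝ) 1)
    (hu : u ∈ Ico (detEntropy (z * (1 - z) * p ^ 2)) (Real.binEntropy (z * p))) :
    (1 - z) / z * invDetEntropy u - (1 - z) * (1 - 2 * z) * p ^ 2
      ∈ Ico (invDetEntropy u) (1 / 4) := by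
  have hz0 := hz.1
  have hz1 : z ∈ Icc (0 : ℝ) 1 := ⟨hz0.le, by linarith [hz.2]⟩
  have hz' : 0 < 1 - z := by linarith [hz.2]
  have hz'' : 0 ≤ 1 - 2 * z := by linarith [hz.2]
  have hsub := Icc_outDet_subset hz1 hp
  obtain ⟨ν, hν, rfl⟩ := exists_detEntropy_outDet_eq ⟨hp, Ico_subset_Icc_self hu⟩
  have hD := outDet_mem hz1 hp hν
  rw [invDetEntropy_detEntropy (hsub hD)]
  have hlt : outDet z p ν < z * p * (1 - z * p) := by
    rw [← strictMonoOn_detEntropy.lt_iff_lt (hsub hD)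
      (hsub (right_mem_Icc.2 (hD.1.trans hD.2))), detEntropy_mul_one_sub]
    exact hu.2
  constructor
  · have h : 0 ≤ (1 - 2 * z) / z * (outDet z p ν - z * (1 - z) * p ^ 2) :=
      mul_nonneg (by positivity) (sub_nonneg.2 hD.1)
    refine le_of_sub_nonneg (h.trans_eq ?_)
    field_simp
    ring
  · calc (1 - z) / z * outDet z p ν - (1 - z) * (1 - 2 * z) * p ^ 2
        < (1 - z) / z * (z * p * (1 - z * p)) - (1 - z) * (1 - 2 * z) * p ^ 2 := by gcongr
      _ = (1 - z) * p * (1 - (1 - z) * p) := by field_simp; ring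
      _ ≤ 1 / 4 := (mul_one_sub_mem_Icc
          ⟨mul_nonneg hz'.le hp.1, mul_le_one₀ (by linarith) hp.1 hp.2⟩).2

theorem concaveOn_complementEntropy {z : ℝ} (hz : z ∈ Ioc (0 : ℝ) (1 / 2)) :
    ConcaveOn ℝ (entropyRegion z) (complementEntropy z) := by
  have hz1 : z ∈ Ioc (0 : ℝ) 1 := ⟨hz.1, by linarith [hz.2]⟩
  have hz' : 0 ≤ 1 - z := sub_nonneg.2 hz1.2
  have hconv := convex_entropyRegion hz1
  refine concaveOn_of_lineMap hconv fun x hx y hy hxy => ?_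
  have hline : ∀ t ∈ Icc (0 : ℝ) 1, AffineMap.lineMap x y t ∈ entropyRegion z :=
    fun t ht => hconv.lineMap_mem hx hy ht
  have hsnd : ∀ t ∈ Ioo (0 : ℝ) 1, (AffineMap.lineMap x y t).2
      < Real.binEntropy (z * (AffineMap.lineMap x y t).1) := fun t ht =>
    lineMap_snd_lt_of_strictConcaveOn (strictConcaveOn_binEntropy_mul hz1)
      ⟨hx.1, hx.2.2⟩ ⟨hy.1, hy.2.2⟩ hxy ht
  have happly : ∀ t : ℝ, AffineMap.lineMap x y t
      = (x.1 + t * (y.1 - x.1), x.2 + t * (y.2 - x.2)) := fun t => by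
    ext <;> simp [AffineMap.lineMap_apply] <;> ring
  have hpos := fun t (ht : t ∈ Ioo (0 : ℝ) 1) => lineMap_fst_pos_of_mem_entropyRegion hx hy hxy ht
  simp only [happly] at hline hsnd hpos ⊢
  refine concaveOn_detEntropy_invDetEntropy_line (div_nonneg hz' hz.1.le)
    (mul_nonneg hz' (by linarith [hz.2])) (fun t ht => ?_) (fun t ht => ⟨?_, ?_⟩) (fun t ht => ?_)
  · exact entropyRegion_snd_mem (Ioc_subset_Icc_self hz1) (hline t ht)
  · exact snd_pos_of_mem_entropyRegion ⟨hz.1, by linarith [hz.2]⟩ (hline t (Ioo_subset_Icc_self ht))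
      (hpos t ht)
  · exact (hsnd t ht).trans_le Real.binEntropy_le_log_two
  · have h := hline t (Ioo_subset_Icc_self ht)
    exact complement_det_mem_Ico hz h.1 ⟨h.2.1, hsnd t ht⟩

/-! ### Averaging over an ensemble -/

section Average

variable {ι : Type*} [Fintype ι] {η : ℝ} {q p ν : ι → ℝ}

lemma sum_mul_mem_Icc (hq : ∀ i, 0 ≤ q i) (hq1 : ∑ i, q i = 1) (hp : ∀ i, p i ∈ Icc (0 : ℝ) 1) :
    ∑ i, q i * p i ∈ Icc (0 : ℝ) 1 :=
  (convex_Icc 0 1).sum_mem (fun i _ => hq i) hq1 fun i _ => hp i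

lemma outDet_le_outDet_one_sub (hη : η ≤ 1 / 2) {p ν : ℝ} (hp : p ∈ Icc (0 : ℝ) 1)
    (hν : ν ∈ Icc (0 : ℝ) 1) : outDet η p ν ≤ outDet (1 - η) p ν := by
  have hν2 : ν ^ 2 ≤ 1 := pow_le_one₀ hν.1 hν.2
  have h : 0 ≤ (1 - 2 * η) * (p * (1 - p)) * (1 - ν ^ 2) :=
    mul_nonneg (mul_nonneg (by linarith) (mul_one_sub_mem_Icc hp).1) (sub_nonneg.2 hν2)
  refine le_of_sub_nonneg (h.trans_eq ?_)
  rw [outDet, outDet]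
  ring

/-- Below transmissivity `1/2` the maximal coherence `ν' = 1` already dominates: the coherent
information is nonpositive, and zero at `ν' = 1`. -/
lemma exists_coherence_of_le_half (hη : η ∈ Icc (0 : ℝ) (1 / 2)) (hq : ∀ i, 0 ≤ q i)
    (hq1 : ∑ i, q i = 1) (hp : ∀ i, p i ∈ Icc (0 : ℝ) 1) (hν : ∀ i, ν i ∈ Icc (0 : ℝ) 1) :
    ∃ ν' ∈ Icc (0 : ℝ) 1,
      detEntropy (outDet (1 - η) (∑ i, q i * p i) ν')
        ≤ ∑ i, q i * detEntropy (outDet (1 - η) (p i) (ν i)) ∧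
      ∑ i, q i * (detEntropy (outDet η (p i) (ν i)) - detEntropy (outDet (1 - η) (p i) (ν i)))
        ≤ detEntropy (outDet η (∑ i, q i * p i) ν')
          - detEntropy (outDet (1 - η) (∑ i, q i * p i) ν') := by
  have hη1 : η ∈ Icc (0 : ℝ) 1 := ⟨hη.1, by linarith [hη.2]⟩
  have hη2 : 1 - η ∈ Icc (0 : ℝ) 1 := ⟨by linarith [hη.2], by linarith [hη.1]⟩
  have hmono := strictMonoOn_detEntropy.monotoneOn
  have hone : (1 : ℝ) ∈ Icc (0 : ℝ) 1 := right_mem_Icc.2 zero_le_one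
  refine ⟨1, hone, ?_, ?_⟩
  · calc detEntropy (outDet (1 - η) (∑ i, q i * p i) 1)
        ≤ ∑ i, q i * detEntropy (outDet (1 - η) (p i) 1) := by
          simpa only [outDet_one, smul_eq_mul] using
            (convexOn_detEntropy_mul_sq (mul_one_sub_mem_Icc hη2)).map_sum_le
              (fun i _ => hq i) hq1 fun i _ => hp i
      _ ≤ _ := by
          refine Finset.sum_le_sum fun i _ => mul_le_mul_of_nonneg_left ?_ (hq i)
          exact hmono (outDet_mem_Icc hη2 (hp i) hone) (outDet_mem_Icc hη2 (hp i) (hν i))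
            (antitoneOn_outDet hη2.1 (hp i) (hν i).1 hone.1 (hν i).2)
  · have hzero : outDet η (∑ i, q i * p i) 1 = outDet (1 - η) (∑ i, q i * p i) 1 := by
      rw [outDet_one, outDet_one]; ring
    rw [hzero, sub_self]
    refine Finset.sum_nonpos fun i _ => mul_nonpos_of_nonneg_of_nonpos (hq i) (sub_nonpos.2 ?_)
    exact hmono (outDet_mem_Icc hη1 (hp i) (hν i)) (outDet_mem_Icc hη2 (hp i) (hν i))
      (outDet_le_outDet_one_sub hη.2 (hp i) (hν i))

/-- Above transmissivity `1/2` the coherence `ν'` is the one that preserves the average entropy of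
the environment. -/
lemma exists_coherence_of_half_le (hη : η ∈ Ico (1 / 2 : ℝ) 1) (hq : ∀ i, 0 ≤ q i)
    (hq1 : ∑ i, q i = 1) (hp : ∀ i, p i ∈ Icc (0 : ℝ) 1) (hν : ∀ i, ν i ∈ Icc (0 : ℝ) 1) :
    ∃ ν' ∈ Icc (0 : ℝ) 1,
      detEntropy (outDet (1 - η) (∑ i, q i * p i) ν')
        = ∑ i, q i * detEntropy (outDet (1 - η) (p i) (ν i)) ∧
      ∑ i, q i * detEntropy (outDet η (p i) (ν i)) ≤ detEntropy (outDet η (∑ i, q i * p i) ν') := by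
  have hz : 1 - η ∈ Ioc (0 : ℝ) (1 / 2) := ⟨by linarith [hη.2], by linarith [hη.1]⟩
  have hz1 : 1 - η ∈ Ioc (0 : ℝ) 1 := ⟨hz.1, by linarith [hz.2]⟩
  let x : ι → ℝ × ℝ := fun i => (p i, detEntropy (outDet (1 - η) (p i) (ν i)))
  have hx : ∀ i, x i ∈ entropyRegion (1 - η) := fun i =>
    mem_entropyRegion (Ioc_subset_Icc_self hz1) (hp i) (hν i)
  have hmean : ∑ i, q i • x i
      = (∑ i, q i * p i, ∑ i, q i * detEntropy (outDet (1 - η) (p i) (ν i))) := by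
    ext <;> simp [x, Prod.fst_sum, Prod.snd_sum]
  have hmem := (convex_entropyRegion hz1).sum_mem (fun i _ => hq i) hq1 fun i _ => hx i
  have hjensen := (concaveOn_complementEntropy hz).le_map_sum (fun i _ => hq i) hq1 fun i _ => hx i
  rw [hmean] at hmem hjensen
  obtain ⟨ν', hν', heq⟩ := exists_detEntropy_outDet_eq hmem
  refine ⟨ν', hν', heq, ?_⟩
  rw [← heq, complementEntropy_apply hz1 (sum_mul_mem_Icc hq hq1 hp) hν'] at hjensen
  simpa only [x, complementEntropy_apply hz1 (hp _) (hν _), sub_sub_cancel, smul_eq_mul]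
    using hjensen

lemma sum_mul_detEntropy_outDet_le (hη : η ∈ Ioc (0 : ℝ) 1) (hq : ∀ i, 0 ≤ q i)
    (hq1 : ∑ i, q i = 1) (hp : ∀ i, p i ∈ Icc (0 : ℝ) 1) (hν : ∀ i, ν i ∈ Icc (0 : ℝ) 1) :
    ∑ i, q i * detEntropy (outDet η (p i) (ν i)) ≤ Real.binEntropy (η * ∑ i, q i * p i) := by
  calc ∑ i, q i * detEntropy (outDet η (p i) (ν i))
      ≤ ∑ i, q i * Real.binEntropy (η * p i) := Finset.sum_le_sum fun i _ =>
        mul_le_mul_of_nonneg_left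
          (mem_entropyRegion (Ioc_subset_Icc_self hη) (hp i) (hν i)).2.2 (hq i)
    _ ≤ _ := by
      simpa only [smul_eq_mul] using
        (strictConcaveOn_binEntropy_mul hη).concaveOn.le_map_sum (fun i _ => hq i) hq1
          fun i _ => hp i

theorem exists_dominating_coherence (hη : η ∈ Icc (0 : ℝ) 1) (hq : ∀ i, 0 ≤ q i)
    (hq1 : ∑ i, q i = 1) (hp : ∀ i, p i ∈ Icc (0 : ℝ) 1) (hν : ∀ i, ν i ∈ Icc (0 : ℝ) 1) :
    ∃ ν' ∈ Icc (0 : ℝ) 1,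
      detEntropy (outDet (1 - η) (∑ i, q i * p i) ν')
        ≤ ∑ i, q i * detEntropy (outDet (1 - η) (p i) (ν i)) ∧
      ∑ i, q i * (detEntropy (outDet η (p i) (ν i)) - detEntropy (outDet (1 - η) (p i) (ν i)))
        ≤ detEntropy (outDet η (∑ i, q i * p i) ν')
          - detEntropy (outDet (1 - η) (∑ i, q i * p i) ν') := by
  rcases le_total η (1 / 2) with hle | hle
  · exact exists_coherence_of_le_half ⟨hη.1, hle⟩ hq hq1 hp hν
  rcases hη.2.eq_or_lt with rfl | hlt
  · have hzero (p ν : ℝ) : outDet (1 - 1) p ν = 0 := by simp [outDet]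
    refine ⟨0, left_mem_Icc.2 zero_le_one, ?_, ?_⟩
    · simp only [hzero, detEntropy_zero, mul_zero, Finset.sum_const_zero, le_refl]
    · simpa only [hzero, detEntropy_zero, sub_zero, outDet_zero, detEntropy_mul_one_sub] using
        sum_mul_detEntropy_outDet_le ⟨one_pos, le_rfl⟩ hq hq1 hp hν
  · obtain ⟨ν', hν', heq, hle'⟩ := exists_coherence_of_half_le ⟨hle, hlt⟩ hq hq1 hp hν
    refine ⟨ν', hν', heq.le, ?_⟩
    simp only [mul_sub, Finset.sum_sub_distrib, heq]
    exact sub_le_sub_right hle' _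

end Average

/-! ### Von Neumann entropy -/

section Entropy

open Matrix

variable {m n X : Type*} [Fintype m] [Fintype n] [Fintype X] [DecidableEq m] [DecidableEq n]
  [DecidableEq X]

lemma entropy_eq_sum_eigenvalues {ρ : Matrix n n ℂ} (h : ρ.IsHermitian) :
    entropy ρ = (∑ i, Real.negMulLog (h.eigenvalues i)) / Real.log 2 := by
  rw [entropy, dif_pos h, ← Finset.sum_neg_distrib, Finset.sum_div]
  refine Finset.sum_congr rfl fun i _ => ?_
  rw [Real.negMulLog, Real.logb]
  ring

lemma entropy_eq_sum_roots_charpoly {ρ : Matrix n n ℂ} (h : ρ.IsHermitian) :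
    entropy ρ = (ρ.charpoly.roots.map fun z => Real.negMulLog z.re).sum / Real.log 2 := by
  rw [entropy_eq_sum_eigenvalues h, h.roots_charpoly_eq_eigenvalues, Multiset.map_map]
  rfl

lemma entropy_transpose {ρ : Matrix n n ℂ} (h : ρ.IsHermitian) : entropy ρᵀ = entropy ρ := by
  rw [entropy_eq_sum_roots_charpoly h.transpose, entropy_eq_sum_roots_charpoly h,
    charpoly_transpose]

lemma entropy_submatrix_equiv {ρ : Matrix n n ℂ} (h : ρ.IsHermitian) (e : m ≃ n) :
    entropy (ρ.submatrix e e) = entropy ρ := by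
  have hcharpoly : (ρ.submatrix e e).charpoly = ρ.charpoly := charpoly_reindex e.symm ρ
  rw [entropy_eq_sum_roots_charpoly (h.submatrix e), entropy_eq_sum_roots_charpoly h, hcharpoly]

lemma entropy_of_charpoly_eq_prod {ρ : Matrix n n ℂ} (h : ρ.IsHermitian) (d : n → ℝ)
    (hd : ρ.charpoly = ∏ i, (Polynomial.X - Polynomial.C (d i : ℂ))) :
    entropy ρ = (∑ i, Real.negMulLog (d i)) / Real.log 2 := by
  rw [entropy_eq_sum_roots_charpoly h, hd, Polynomial.roots_prod _ _
    (Finset.prod_ne_zero_iff.2 fun i _ => Polynomial.X_sub_C_ne_zero _)]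
  simp only [Polynomial.roots_X_sub_C, Multiset.bind_singleton, Multiset.map_map]
  rfl

lemma entropy_diagonal_ofReal (d : n → ℝ) :
    entropy (diagonal fun i => (d i : ℂ)) = (∑ i, Real.negMulLog (d i)) / Real.log 2 :=
  entropy_of_charpoly_eq_prod (isHermitian_diagonal_iff.2 fun _ => Complex.conj_ofReal _) d
    (charpoly_diagonal _)

lemma charpoly_ofReal_smul {ρ : Matrix n n ℂ} (h : ρ.IsHermitian) (q : ℝ) :
    ((q : ℂ) • ρ).charpoly
      = ∏ i, (Polynomial.X - Polynomial.C ((q * h.eigenvalues i : ℝ) : ℂ)) := by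
  conv_lhs => rw [h.spectral_theorem, ← map_smul, Unitary.conjStarAlgAut_apply,
    charpoly_mul_comm, ← mul_assoc]
  rw [Unitary.coe_star_mul_self, one_mul, ← diagonal_smul, charpoly_diagonal]
  simp

lemma entropy_ofReal_smul {ρ : Matrix n n ℂ} (h : ρ.IsHermitian) (q : ℝ) :
    entropy ((q : ℂ) • ρ) = ρ.trace.re * (Real.negMulLog q / Real.log 2) + q * entropy ρ := by
  have htr : ∑ i, h.eigenvalues i = ρ.trace.re := by simp [h.trace_eq_sum_eigenvalues]
  rw [entropy_of_charpoly_eq_prod (h.smul (Complex.conj_ofReal q)) _ (charpoly_ofReal_smul h q),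
    entropy_eq_sum_eigenvalues h, ← htr]
  simp only [Real.negMulLog_mul, Finset.sum_add_distrib, ← Finset.mul_sum, ← Finset.sum_mul]
  ring

lemma charpoly_blockDiagonal {R : Type*} [CommRing R] (M : X → Matrix n n R) :
    (blockDiagonal M).charpoly = ∏ x, (M x).charpoly := by
  have hM : charmatrix (blockDiagonal M) = blockDiagonal fun x => charmatrix (M x) := by
    ext1 ⟨i, x⟩ ⟨j, y⟩
    rcases eq_or_ne x y with rfl | hxy
    · rcases eq_or_ne i j with rfl | hij
      · simp
      · simp [charmatrix_apply_ne, hij]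
    · simp [charmatrix_apply_ne, hxy, blockDiagonal_apply_ne]
  rw [charpoly, hM, det_blockDiagonal]
  rfl

lemma entropy_blockDiagonal {M : X → Matrix n n ℂ} (hM : ∀ x, (M x).IsHermitian) :
    entropy (blockDiagonal M) = ∑ x, entropy (M x) := by
  have hH : (blockDiagonal M).IsHermitian := by
    rw [IsHermitian, blockDiagonal_conjTranspose]
    exact congrArg _ (funext hM)
  have hne : ∏ x, (M x).charpoly ≠ 0 :=
    Finset.prod_ne_zero_iff.2 fun x _ => (charpoly_monic _).ne_zero
  rw [entropy_eq_sum_roots_charpoly hH, charpoly_blockDiagonal, Polynomial.roots_prod _ _ hne,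
    Multiset.map_bind, Multiset.sum_bind]
  simp only [entropy_eq_sum_roots_charpoly (hM _), ← Finset.sum_div]
  rfl

lemma entropy_mul_conjTranspose_self (V : Matrix m n ℂ) : entropy (V * Vᴴ) = entropy (Vᴴ * V) := by
  have hX (k : ℕ) : (Polynomial.X ^ k : Polynomial ℂ) ≠ 0 := pow_ne_zero k Polynomial.X_ne_zero
  have hroots := congrArg (fun p : Polynomial ℂ => (p.roots.map fun z => Real.negMulLog z.re).sum)
    (charpoly_mul_comm' V Vᴴ)
  simp only [Polynomial.roots_mul (mul_ne_zero (hX _) (charpoly_monic _).ne_zero),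
    Polynomial.roots_X_pow] at hroots
  rw [entropy_eq_sum_roots_charpoly (isHermitian_mul_conjTranspose_self V),
    entropy_eq_sum_roots_charpoly (isHermitian_conjTranspose_mul_self V)]
  congr 1
  simpa [Multiset.nsmul_singleton] using hroots

lemma entropy_fin_two {ρ : Matrix (Fin 2) (Fin 2) ℂ} (h : ρ.IsHermitian) (htr : ρ.trace = 1) :
    entropy ρ = detEntropy ρ.det.re / Real.log 2 := by
  have hsum : h.eigenvalues 0 + h.eigenvalues 1 = 1 := by
    simpa [htr, Fin.sum_univ_two] using (congrArg Complex.re h.trace_eq_sum_eigenvalues).symm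
  have hdet : ρ.det.re = h.eigenvalues 0 * h.eigenvalues 1 := by
    simp [h.det_eq_prod_eigenvalues, Fin.prod_univ_two]
  rw [entropy_eq_sum_eigenvalues h, Fin.sum_univ_two, hdet, eq_sub_of_add_eq' hsum,
    detEntropy_mul_one_sub, Real.binEntropy_eq_negMulLog_add_negMulLog_one_sub]

end Entropy

/-! ### Density matrices and Kraus maps -/

section Density

open Matrix
open scoped ComplexOrder

variable {m n : Type*} [Fintype m]

lemma traceLeft_eq_sum_submatrix (M : Matrix (m × n) (m × n) ℂ) :
    traceLeft M = ∑ a, M.submatrix (Prod.mk a) (Prod.mk a) := by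
  ext i j
  simp [traceLeft, Matrix.sum_apply]

lemma posSemidef_traceLeft {M : Matrix (m × n) (m × n) ℂ} (hM : M.PosSemidef) :
    (traceLeft M).PosSemidef := by
  rw [traceLeft_eq_sum_submatrix]
  exact posSemidef_sum _ fun a _ => hM.submatrix _

lemma traceLeft_applyRight {B : Type*} (𝒩 : Matrix n n ℂ →ₗ[ℂ] Matrix B B ℂ)
    (M : Matrix (m × n) (m × n) ℂ) : traceLeft (applyRight 𝒩 M) = 𝒩 (traceLeft M) := by
  rw [traceLeft_eq_sum_submatrix M, map_sum]
  ext i j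
  simp only [traceLeft, applyRight, Matrix.sum_apply, of_apply]
  rfl

lemma posSemidef_ketBra [Finite n] (φ : n → ℂ) : (ketBra φ).PosSemidef :=
  posSemidef_vecMulVec_self_star φ

variable [Fintype n]

/-- Density matrices: the states of a finite-dimensional quantum system. -/
structure IsDensityMatrix (ρ : Matrix n n ℂ) : Prop where
  posSemidef : ρ.PosSemidef
  trace_eq_one : ρ.trace = 1

lemma IsDensityMatrix.isHermitian {ρ : Matrix n n ℂ} (hρ : IsDensityMatrix ρ) : ρ.IsHermitian :=
  hρ.posSemidef.isHermitian

lemma IsDensityMatrix.sum {X : Type*} [Fintype X] {q : X → ℝ} {ρ : X → Matrix n n ℂ}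
    (hq : ∀ x, 0 ≤ q x) (hq1 : ∑ x, q x = 1) (hρ : ∀ x, IsDensityMatrix (ρ x)) :
    IsDensityMatrix (∑ x, (q x : ℂ) • ρ x) where
  posSemidef := posSemidef_sum _ fun x _ =>
    (hρ x).posSemidef.smul (Complex.zero_le_real.2 (hq x))
  trace_eq_one := by
    simp only [trace_sum, trace_smul, (hρ _).trace_eq_one, smul_eq_mul, mul_one]
    exact_mod_cast hq1

lemma trace_ketBra (φ : n → ℂ) : (ketBra φ).trace = ((∑ i, ‖φ i‖ ^ 2 : ℝ) : ℂ) := by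
  simp [ketBra, Matrix.trace, vecMulVec_apply, Complex.mul_conj']

lemma trace_traceLeft (M : Matrix (m × n) (m × n) ℂ) : (traceLeft M).trace = M.trace := by
  simp only [traceLeft, Matrix.trace, diag_apply, of_apply, Fintype.sum_prod_type]
  exact Finset.sum_comm

lemma isDensityMatrix_traceLeft_ketBra {φ : m × n → ℂ} (hφ : ∑ i, ‖φ i‖ ^ 2 = 1) :
    IsDensityMatrix (traceLeft (ketBra φ)) where
  posSemidef := posSemidef_traceLeft (posSemidef_ketBra φ)
  trace_eq_one := by rw [trace_traceLeft, trace_ketBra, hφ, Complex.ofReal_one]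

end Density

section Kraus

open Matrix
open scoped ComplexOrder

variable {J A A' B : Type*} [Fintype A']

lemma krausMap_apply [Fintype J] (K : J → Matrix B A' ℂ) (ρ : Matrix A' A' ℂ) :
    krausMap K ρ = ∑ j, K j * ρ * (K j)ᴴ := rfl

lemma trace_krausMap [Fintype J] [Fintype B] [DecidableEq A'] {K : J → Matrix B A' ℂ}
    (hK : ∑ j, (K j)ᴴ * K j = 1) (ρ : Matrix A' A' ℂ) : (krausMap K ρ).trace = ρ.trace := by
  calc (krausMap K ρ).trace = ((∑ j, (K j)ᴴ * K j) * ρ).trace := by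
        simp only [krausMap_apply, trace_sum, Finset.sum_mul]
        exact Finset.sum_congr rfl fun j _ => by rw [trace_mul_comm, Matrix.mul_assoc]
    _ = ρ.trace := by rw [hK, one_mul]

lemma IsDensityMatrix.krausMap [Fintype J] [Fintype B] [DecidableEq A'] {K : J → Matrix B A' ℂ}
    (hK : ∑ j, (K j)ᴴ * K j = 1) {ρ : Matrix A' A' ℂ} (hρ : IsDensityMatrix ρ) :
    IsDensityMatrix (krausMap K ρ) where
  posSemidef := posSemidef_sum _ fun j _ => hρ.posSemidef.mul_mul_conjTranspose_same (K j)
  trace_eq_one := by rw [trace_krausMap hK, hρ.trace_eq_one]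

/-- The complementary map of `krausMap K`: what the environment, which holds the index of the
Kraus operator, receives. -/
def complementaryMap [Fintype B] (K : J → Matrix B A' ℂ) (ρ : Matrix A' A' ℂ) : Matrix J J ℂ :=
  Matrix.of fun j k => (K j * ρ * (K k)ᴴ).trace

/-- The Stinespring dilation of `krausMap K` applied to the vector `φ`, as a matrix between the
output and the environment: its columns are the vectors `(1 ⊗ Kⱼ) φ`. -/
def krausVector (K : J → Matrix B A' ℂ) (φ : A × A' → ℂ) : Matrix (A × B) J ℂ :=
  Matrix.of fun i j => ∑ s, K j i.2 s * φ (i.1, s)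

lemma applyRight_krausMap_ketBra [Fintype J] (K : J → Matrix B A' ℂ) (φ : A × A' → ℂ) :
    applyRight (krausMap K) (ketBra φ) = krausVector K φ * (krausVector K φ)ᴴ := by
  ext ⟨a, b⟩ ⟨a', b'⟩
  simp only [applyRight, krausMap_apply, krausVector, ketBra, of_apply, Matrix.sum_apply,
    Matrix.mul_apply, conjTranspose_apply, vecMulVec_apply, Pi.star_apply, star_sum, star_mul',
    Finset.mul_sum, Finset.sum_mul]
  exact Finset.sum_congr rfl fun j _ => Finset.sum_congr rfl fun t _ =>
    Finset.sum_congr rfl fun s _ => by ring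

lemma complementaryMap_traceLeft_ketBra [Fintype A] [Fintype B] (K : J → Matrix B A' ℂ)
    (φ : A × A' → ℂ) :
    complementaryMap K (traceLeft (ketBra φ)) = ((krausVector K φ)ᴴ * krausVector K φ)ᵀ := by
  ext k j
  simp only [complementaryMap, krausVector, ketBra, traceLeft, Matrix.trace, diag_apply, of_apply,
    Matrix.mul_apply, transpose_apply, conjTranspose_apply, vecMulVec_apply, Pi.star_apply,
    star_sum, star_mul', Fintype.sum_prod_type, Finset.sum_mul, Finset.mul_sum]
  rw [Finset.sum_comm (s := (Finset.univ : Finset A))]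
  refine Finset.sum_congr rfl fun b _ => ?_
  rw [Finset.sum_comm (s := (Finset.univ : Finset A)), Finset.sum_comm]
  refine Finset.sum_congr rfl fun t _ => ?_
  rw [Finset.sum_comm]
  exact Finset.sum_congr rfl fun s _ => Finset.sum_congr rfl fun a _ => by ring

lemma entropy_applyRight_krausMap_ketBra [Fintype J] [Fintype A] [Fintype B] [DecidableEq J]
    [DecidableEq A] [DecidableEq B] (K : J → Matrix B A' ℂ) (φ : A × A' → ℂ) :
    entropy (applyRight (krausMap K) (ketBra φ))
      = entropy (complementaryMap K (traceLeft (ketBra φ))) := by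
  rw [applyRight_krausMap_ketBra, entropy_mul_conjTranspose_self,
    complementaryMap_traceLeft_ketBra,
    entropy_transpose (isHermitian_conjTranspose_mul_self _)]

end Kraus

/-! ### Information rates of an ensemble -/

section ClassicalQuantum

open Matrix
open scoped Kronecker

variable {X A B n : Type*} [Fintype X] [DecidableEq X]

/-- The classical-quantum matrix `∑ₓ q(x) |x⟩⟨x| ⊗ Mₓ`; `Ensemble.cqState` is of this form. -/
def cqMatrix (q : X → ℝ) (M : X → Matrix n n ℂ) : Matrix (X × n) (X × n) ℂ :=
  ∑ x, (q x : ℂ) • (Matrix.single x x (1 : ℂ) ⊗ₖ M x)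

lemma cqMatrix_apply (q : X → ℝ) (M : X → Matrix n n ℂ) (i j : X × n) :
    cqMatrix q M i j = if i.1 = j.1 then (q i.1 : ℂ) * M i.1 i.2 j.2 else 0 := by
  simp [cqMatrix, Matrix.sum_apply, single_apply, ite_and]

lemma traceMiddle_cqMatrix [Fintype A] (q : X → ℝ) (M : X → Matrix (A × B) (A × B) ℂ) :
    traceMiddle (cqMatrix q M) = cqMatrix q fun x => traceLeft (M x) := by
  ext i j
  simp [traceMiddle, cqMatrix_apply, traceLeft, Finset.sum_ite_irrel, Finset.mul_sum]

lemma traceLeft_cqMatrix (q : X → ℝ) (M : X → Matrix n n ℂ) :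
    traceLeft (cqMatrix q M) = ∑ x, (q x : ℂ) • M x := by
  ext i j
  simp [traceLeft, cqMatrix_apply, Matrix.sum_apply]

lemma traceRight_cqMatrix [Fintype n] (q : X → ℝ) {M : X → Matrix n n ℂ}
    (htr : ∀ x, (M x).trace = 1) :
    traceRight (cqMatrix q M) = diagonal fun x => (q x : ℂ) := by
  ext x y
  have hx : ∑ i, M x i i = 1 := htr x
  simp [traceRight, cqMatrix_apply, diagonal_apply, Finset.sum_ite_irrel, ← Finset.mul_sum, hx]

lemma cqMatrix_eq_submatrix_blockDiagonal (q : X → ℝ) (M : X → Matrix n n ℂ) :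
    cqMatrix q M = (blockDiagonal fun x => (q x : ℂ) • M x).submatrix
      (Equiv.prodComm X n) (Equiv.prodComm X n) := by
  ext i j
  simp [cqMatrix_apply, blockDiagonal_apply]

lemma entropy_cqMatrix [Fintype n] [DecidableEq n] (q : X → ℝ) {M : X → Matrix n n ℂ}
    (hM : ∀ x, (M x).IsHermitian) (htr : ∀ x, (M x).trace = 1) :
    entropy (cqMatrix q M)
      = (∑ x, Real.negMulLog (q x)) / Real.log 2 + ∑ x, q x * entropy (M x) := by
  have hqM (x : X) : ((q x : ℂ) • M x).IsHermitian := (hM x).smul (Complex.conj_ofReal (q x))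
  have hblock : (blockDiagonal fun x => (q x : ℂ) • M x).IsHermitian := by
    rw [IsHermitian, blockDiagonal_conjTranspose]
    exact congrArg _ (funext hqM)
  rw [cqMatrix_eq_submatrix_blockDiagonal, entropy_submatrix_equiv hblock,
    entropy_blockDiagonal hqM]
  simp only [entropy_ofReal_smul (hM _), htr, Complex.one_re, one_mul, Finset.sum_add_distrib,
    Finset.sum_div]

end ClassicalQuantum

namespace Ensemble

open Matrix

variable {J X A A' B : Type*} [Fintype X] [Fintype A] [Fintype A']

lemma isDensityMatrix_inputState (e : Ensemble X A A') (x : X) :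
    IsDensityMatrix (e.inputState x) :=
  isDensityMatrix_traceLeft_ketBra (e.φ_unit x)

lemma traceLeft_applyRight_ketBra (e : Ensemble X A A') (𝒩 : Matrix A' A' ℂ →ₗ[ℂ] Matrix B B ℂ)
    (x : X) : traceLeft (applyRight 𝒩 (ketBra (e.φ x))) = 𝒩 (e.inputState x) :=
  traceLeft_applyRight 𝒩 _

lemma cqState_eq_cqMatrix [DecidableEq X] (e : Ensemble X A A')
    (𝒩 : Matrix A' A' ℂ →ₗ[ℂ] Matrix B B ℂ) :
    e.cqState 𝒩 = cqMatrix e.prob fun x => applyRight 𝒩 (ketBra (e.φ x)) := rfl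

lemma traceLeft_traceLeft_cqState [DecidableEq X] (e : Ensemble X A A')
    (𝒩 : Matrix A' A' ℂ →ₗ[ℂ] Matrix B B ℂ) :
    traceLeft (traceLeft (e.cqState 𝒩)) = 𝒩 (∑ x, (e.prob x : ℂ) • e.inputState x) := by
  simp only [map_sum, map_smul, ← traceLeft_applyRight_ketBra]
  rw [cqState_eq_cqMatrix, traceLeft_cqMatrix]
  ext i j
  simp only [traceLeft, Matrix.sum_apply, Matrix.smul_apply, of_apply, Finset.smul_sum]
  exact Finset.sum_comm

variable [Fintype J] [Fintype B] [DecidableEq A'] {K : J → Matrix B A' ℂ}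

lemma trace_applyRight_krausMap (hK : ∑ j, (K j)ᴴ * K j = 1) (e : Ensemble X A A') (x : X) :
    (applyRight (krausMap K) (ketBra (e.φ x))).trace = 1 := by
  rw [← trace_traceLeft, e.traceLeft_applyRight_ketBra,
    ((e.isDensityMatrix_inputState x).krausMap hK).trace_eq_one]

variable [DecidableEq X]

lemma entropy_traceRight_cqState_krausMap (hK : ∑ j, (K j)ᴴ * K j = 1) (e : Ensemble X A A') :
    entropy (traceRight (e.cqState (krausMap K)))
      = (∑ x, Real.negMulLog (e.prob x)) / Real.log 2 := by
  rw [cqState_eq_cqMatrix, traceRight_cqMatrix _ (e.trace_applyRight_krausMap hK),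
    entropy_diagonal_ofReal]

variable [DecidableEq B]

lemma entropy_traceMiddle_cqState_krausMap (hK : ∑ j, (K j)ᴴ * K j = 1) (e : Ensemble X A A') :
    entropy (traceMiddle (e.cqState (krausMap K)))
      = (∑ x, Real.negMulLog (e.prob x)) / Real.log 2
        + ∑ x, e.prob x * entropy (krausMap K (e.inputState x)) := by
  have hρ (x : X) := (e.isDensityMatrix_inputState x).krausMap hK
  rw [cqState_eq_cqMatrix, traceMiddle_cqMatrix]
  simp only [traceLeft_applyRight_ketBra]
  exact entropy_cqMatrix _ (fun x => (hρ x).isHermitian) fun x => (hρ x).trace_eq_one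

variable [DecidableEq J] [DecidableEq A]

lemma entropy_cqState_krausMap (hK : ∑ j, (K j)ᴴ * K j = 1) (e : Ensemble X A A') :
    entropy (e.cqState (krausMap K))
      = (∑ x, Real.negMulLog (e.prob x)) / Real.log 2
        + ∑ x, e.prob x * entropy (complementaryMap K (e.inputState x)) := by
  have hH (x : X) : (applyRight (krausMap K) (ketBra (e.φ x))).IsHermitian := by
    rw [applyRight_krausMap_ketBra]
    exact isHermitian_mul_conjTranspose_self _
  rw [cqState_eq_cqMatrix, entropy_cqMatrix _ hH (e.trace_applyRight_krausMap hK)]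
  simp only [entropy_applyRight_krausMap_ketBra, inputState]

theorem coherentInfo_krausMap (hK : ∑ j, (K j)ᴴ * K j = 1) (e : Ensemble X A A') :
    e.coherentInfo (krausMap K) = ∑ x, e.prob x *
      (entropy (krausMap K (e.inputState x)) - entropy (complementaryMap K (e.inputState x))) := by
  rw [coherentInfo, e.entropy_cqState_krausMap hK, e.entropy_traceMiddle_cqState_krausMap hK]
  simp only [mul_sub, Finset.sum_sub_distrib]
  ring

theorem holevoInfo_add_coherentInfo_krausMap (hK : ∑ j, (K j)ᴴ * K j = 1)
    (e : Ensemble X A A') :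
    e.holevoInfo (krausMap K) + e.coherentInfo (krausMap K)
      = entropy (krausMap K (∑ x, (e.prob x : ℂ) • e.inputState x))
        - ∑ x, e.prob x * entropy (complementaryMap K (e.inputState x)) := by
  rw [holevoInfo, coherentInfo, e.entropy_cqState_krausMap hK,
    e.entropy_traceRight_cqState_krausMap hK, e.traceLeft_traceLeft_cqState]
  ring

end Ensemble

/-! ### The amplitude damping channel -/

section Damping

open Matrix

/-- The Kraus operators of the amplitude damping channel. -/
def dampingKraus (η : ℝ) : Fin 2 → Matrix (Fin 2) (Fin 2) ℂ :=
  ![!![1, 0; 0, (√η : ℂ)], !![0, (√(1 - η) : ℂ); 0, 0]]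

lemma krausMap_dampingKraus (η : ℝ) : krausMap (dampingKraus η) = amplitudeDamping η := rfl

lemma ofReal_sqrt_mul_self {x : ℝ} (hx : 0 ≤ x) : (√x : ℂ) * √x = x := by
  exact_mod_cast Real.mul_self_sqrt hx

lemma sum_conjTranspose_dampingKraus_mul {η : ℝ} (hη : η ∈ Icc (0 : ℝ) 1) :
    ∑ j, (dampingKraus η j)ᴴ * dampingKraus η j = 1 := by
  have hη0 := ofReal_sqrt_mul_self hη.1
  have hη1 := ofReal_sqrt_mul_self (sub_nonneg.2 hη.2)
  rw [Fin.sum_univ_two]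
  ext i j
  fin_cases i <;> fin_cases j <;> simp [dampingKraus, mul_apply, hη0, hη1]

lemma amplitudeDamping_apply {η : ℝ} (hη : η ∈ Icc (0 : ℝ) 1) (ρ : Matrix (Fin 2) (Fin 2) ℂ) :
    amplitudeDamping η ρ
      = !![ρ 0 0 + (1 - η) * ρ 1 1, √η * ρ 0 1; √η * ρ 1 0, η * ρ 1 1] := by
  have hη0 := ofReal_sqrt_mul_self hη.1
  have hη1 := ofReal_sqrt_mul_self (sub_nonneg.2 hη.2)
  rw [← krausMap_dampingKraus, krausMap_apply, Fin.sum_univ_two]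
  ext i j
  simp only [Matrix.add_apply, mul_apply, Fin.sum_univ_two, conjTranspose_apply]
  fin_cases i <;> fin_cases j <;>
    simp [dampingKraus, mul_right_comm _ (ρ _ _), hη0, hη1]
  all_goals ring

lemma complementaryMap_dampingKraus {η : ℝ} (hη : η ∈ Icc (0 : ℝ) 1)
    (ρ : Matrix (Fin 2) (Fin 2) ℂ) :
    complementaryMap (dampingKraus η) ρ = amplitudeDamping (1 - η) ρ := by
  have hη0 := ofReal_sqrt_mul_self hη.1
  have hη1 := ofReal_sqrt_mul_self (sub_nonneg.2 hη.2)
  rw [amplitudeDamping_apply (Icc.mem_iff_one_sub_mem.1 hη)]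
  ext i j
  fin_cases i <;> fin_cases j <;>
    simp [complementaryMap, trace_fin_two, dampingKraus, mul_apply, mul_right_comm _ (ρ _ _),
      hη0, hη1]
  all_goals ring

/-- The population of the excited state, the one that decays. -/
def population (ρ : Matrix (Fin 2) (Fin 2) ℂ) : ℝ := (ρ 1 1).re

/-- The off-diagonal entry of `ρ` has modulus `|ν| √(p (1 - p))` with `p = population ρ`: relative
to the largest value that positivity allows, the coherence of `ρ` is `ν`. Squared, the condition
is polynomial in `ν`. -/
def HasCoherence (ρ : Matrix (Fin 2) (Fin 2) ℂ) (ν : ℝ) : Prop :=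
  ‖ρ 0 1‖ ^ 2 = ν ^ 2 * (population ρ * (1 - population ρ))

lemma h2_eq (y : ℝ) : h2 y = Real.binEntropy y / Real.log 2 := by
  rw [h2, Real.logb, Real.logb, Real.binEntropy_eq_negMulLog_add_negMulLog_one_sub,
    Real.negMulLog, Real.negMulLog]
  ring

lemma g_eq (q z ν : ℝ) : g q z ν = detEntropy (outDet z q ν) / Real.log 2 := by
  rw [g, h2_eq, detEntropy, outDet]
  ring_nf

lemma g_zero (q z : ℝ) : g q z 0 = h2 (z * q) := by
  rw [g_eq, h2_eq, outDet_zero, detEntropy_mul_one_sub]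

lemma g_le_h2 {q z ν : ℝ} (hq : q ∈ Icc (0 : ℝ) 1) (hz : z ∈ Icc (0 : ℝ) 1)
    (hν : ν ∈ Icc (0 : ℝ) 1) : g q z ν ≤ h2 (z * q) := by
  rw [g_eq, h2_eq]
  exact div_le_div_of_nonneg_right (mem_entropyRegion hz hq hν).2.2
    (Real.log_nonneg one_le_two)

lemma isHermitian_amplitudeDamping (η : ℝ) {ρ : Matrix (Fin 2) (Fin 2) ℂ} (h : ρ.IsHermitian) :
    (amplitudeDamping η ρ).IsHermitian := by
  rw [← krausMap_dampingKraus, krausMap_apply, IsHermitian, conjTranspose_sum]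
  exact Finset.sum_congr rfl fun j _ => isHermitian_mul_mul_conjTranspose _ h

lemma entropy_amplitudeDamping {z ν : ℝ} (hz : z ∈ Icc (0 : ℝ) 1) {ρ : Matrix (Fin 2) (Fin 2) ℂ}
    (h : ρ.IsHermitian) (htr : ρ.trace = 1) (hν : HasCoherence ρ ν) :
    entropy (amplitudeDamping z ρ) = g (population ρ) z ν := by
  have h11 : ρ 1 1 = population ρ := (h.coe_re_apply_self 1).symm
  have h00 : ρ 0 0 = 1 - population ρ := by
    rw [← htr, trace_fin_two, h11, add_sub_cancel_right]
  have h01 : ρ 0 1 * ρ 1 0 = ((ν ^ 2 * (population ρ * (1 - population ρ)) : ℝ) : ℂ) := by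
    rw [← h.apply 1 0, Complex.star_def, Complex.mul_conj', ← show ‖ρ 0 1‖ ^ 2 = _ from hν,
      Complex.ofReal_pow]
  have hdet : (amplitudeDamping z ρ).det = (outDet z (population ρ) ν : ℂ) := by
    rw [amplitudeDamping_apply hz, det_fin_two_of, h00, h11, mul_mul_mul_comm (√z : ℂ),
      ofReal_sqrt_mul_self hz.1, h01, outDet]
    push_cast
    ring
  have htr' : (amplitudeDamping z ρ).trace = 1 := by
    rw [← krausMap_dampingKraus, trace_krausMap (sum_conjTranspose_dampingKraus_mul hz), htr]
  rw [entropy_fin_two (isHermitian_amplitudeDamping z h) htr', hdet, Complex.ofReal_re, g_eq]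

end Damping

section Qubit

open Matrix
open scoped ComplexOrder

variable {ρ : Matrix (Fin 2) (Fin 2) ℂ}

lemma population_sum {X : Type*} [Fintype X] (q : X → ℝ) (ρ : X → Matrix (Fin 2) (Fin 2) ℂ) :
    population (∑ x, (q x : ℂ) • ρ x) = ∑ x, q x * population (ρ x) := by
  simp [population, Matrix.sum_apply]

lemma IsDensityMatrix.one_sub_population (hρ : IsDensityMatrix ρ) :
    1 - population ρ = (ρ 0 0).re := by
  have htr : (ρ 0 0).re + (ρ 1 1).re = 1 := by
    simpa [trace_fin_two] using congrArg Complex.re hρ.trace_eq_one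
  rw [← htr, population, add_sub_cancel_right]

lemma IsDensityMatrix.population_mem (hρ : IsDensityMatrix ρ) :
    population ρ ∈ Icc (0 : ℝ) 1 := by
  have hdiag (i : Fin 2) : 0 ≤ (ρ i i).re := (Complex.le_def.1 hρ.posSemidef.diag_nonneg).1
  exact ⟨hdiag 1, sub_nonneg.1 (hρ.one_sub_population ▸ hdiag 0)⟩

lemma IsDensityMatrix.norm_sq_le (hρ : IsDensityMatrix ρ) :
    ‖ρ 0 1‖ ^ 2 ≤ population ρ * (1 - population ρ) := by
  have hre (i : Fin 2) : ρ i i = ((ρ i i).re : ℂ) := (hρ.isHermitian.coe_re_apply_self i).symm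
  have hdet : ρ.det = (((ρ 0 0).re * (ρ 1 1).re - ‖ρ 0 1‖ ^ 2 : ℝ) : ℂ) := by
    rw [det_fin_two, ← hρ.isHermitian.apply 1 0, Complex.star_def, Complex.mul_conj', hre 0, hre 1]
    push_cast [Complex.ofReal_re]
    rfl
  have hnonneg := hρ.posSemidef.det_nonneg
  rw [hdet, Complex.zero_le_real] at hnonneg
  rw [hρ.one_sub_population, population, mul_comm]
  exact sub_nonneg.1 hnonneg

lemma IsDensityMatrix.exists_hasCoherence (hρ : IsDensityMatrix ρ) :
    ∃ ν ∈ Icc (0 : ℝ) 1, HasCoherence ρ ν := by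
  have hle := hρ.norm_sq_le
  have hv : 0 ≤ population ρ * (1 - population ρ) := (sq_nonneg _).trans hle
  refine ⟨‖ρ 0 1‖ / √(population ρ * (1 - population ρ)), ⟨by positivity,
    div_le_one_of_le₀ (Real.le_sqrt_of_sq_le hle) (Real.sqrt_nonneg _)⟩, ?_⟩
  rw [HasCoherence, div_pow, Real.sq_sqrt hv]
  rcases hv.eq_or_lt with hzero | hpos
  · rw [← hzero] at hle ⊢
    simpa using le_antisymm hle (sq_nonneg _)
  · rw [div_mul_cancel₀ _ hpos.ne']

end Qubit

namespace Ensemble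

variable {X A : Type*} [Fintype X] [Fintype A] [DecidableEq X] [DecidableEq A] {η : ℝ}
  {ν : X → ℝ}

lemma coherentInfo_amplitudeDamping (hη : η ∈ Icc (0 : ℝ) 1) (e : Ensemble X A (Fin 2))
    (hν : ∀ x, HasCoherence (e.inputState x) (ν x)) :
    e.coherentInfo (amplitudeDamping η) = ∑ x, e.prob x *
      (g (population (e.inputState x)) η (ν x)
        - g (population (e.inputState x)) (1 - η) (ν x)) := by
  rw [← krausMap_dampingKraus, e.coherentInfo_krausMap (sum_conjTranspose_dampingKraus_mul hη)]
  refine Finset.sum_congr rfl fun x _ => ?_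
  have hρ := e.isDensityMatrix_inputState x
  rw [complementaryMap_dampingKraus hη, krausMap_dampingKraus,
    entropy_amplitudeDamping hη hρ.isHermitian hρ.trace_eq_one (hν x),
    entropy_amplitudeDamping (Icc.mem_iff_one_sub_mem.1 hη) hρ.isHermitian hρ.trace_eq_one (hν x)]

lemma holevoInfo_add_coherentInfo_amplitudeDamping (hη : η ∈ Icc (0 : ℝ) 1)
    (e : Ensemble X A (Fin 2)) (hν : ∀ x, HasCoherence (e.inputState x) (ν x)) {μ : ℝ}
    (hμ : HasCoherence (∑ x, (e.prob x : ℂ) • e.inputState x) μ) :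
    e.holevoInfo (amplitudeDamping η) + e.coherentInfo (amplitudeDamping η)
      = g (∑ x, e.prob x * population (e.inputState x)) η μ
        - ∑ x, e.prob x * g (population (e.inputState x)) (1 - η) (ν x) := by
  have hav := IsDensityMatrix.sum e.prob_nonneg e.prob_sum e.isDensityMatrix_inputState
  rw [← krausMap_dampingKraus,
    e.holevoInfo_add_coherentInfo_krausMap (sum_conjTranspose_dampingKraus_mul hη),
    krausMap_dampingKraus, entropy_amplitudeDamping hη hav.isHermitian hav.trace_eq_one hμ,
    population_sum]
  congr 1
  refine Finset.sum_congr rfl fun x _ => ?_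
  have hρ := e.isDensityMatrix_inputState x
  rw [complementaryMap_dampingKraus hη, entropy_amplitudeDamping (Icc.mem_iff_one_sub_mem.1 hη)
    hρ.isHermitian hρ.trace_eq_one (hν x)]

theorem exists_dominating_parameters (hη : η ∈ Icc (0 : ℝ) 1) (e : Ensemble X A (Fin 2)) :
    ∃ p ∈ Icc (0 : ℝ) 1, ∃ ν ∈ Icc (0 : ℝ) 1,
      e.coherentInfo (amplitudeDamping η) ≤ g p η ν - g p (1 - η) ν ∧
      e.holevoInfo (amplitudeDamping η) + e.coherentInfo (amplitudeDamping η)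
        ≤ h2 (η * p) - g p (1 - η) ν := by
  have hρ := e.isDensityMatrix_inputState
  have hp (x : X) := (hρ x).population_mem
  choose ν hν hcoh using fun x => (hρ x).exists_hasCoherence
  obtain ⟨μ, hμ, hcohμ⟩ :=
    (IsDensityMatrix.sum e.prob_nonneg e.prob_sum hρ).exists_hasCoherence
  obtain ⟨ν', hν', henv, hdiff⟩ := exists_dominating_coherence hη e.prob_nonneg e.prob_sum hp hν
  have hpav := sum_mul_mem_Icc e.prob_nonneg e.prob_sum hp
  have hlog : 0 ≤ Real.log 2 := Real.log_nonneg one_le_two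
  refine ⟨_, hpav, ν', hν', ?_, ?_⟩
  · rw [e.coherentInfo_amplitudeDamping hη hcoh]
    simp only [g_eq, ← sub_div, ← mul_div_assoc, ← Finset.sum_div]
    exact div_le_div_of_nonneg_right hdiff hlog
  · rw [e.holevoInfo_add_coherentInfo_amplitudeDamping hη hcoh hcohμ]
    refine sub_le_sub (g_le_h2 hpav hη hμ) ?_
    simp only [g_eq, ← mul_div_assoc, ← Finset.sum_div]
    exact div_le_div_of_nonneg_right henv hlog

end Ensemble

/-! ### Symmetric ensembles -/

section Symmetric

lemma population_qubitState (p ν : ℝ) : population (qubitState p ν) = p := by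
  simp [population, qubitState]

lemma hasCoherence_qubitState {p : ℝ} (hp : p ∈ Icc (0 : ℝ) 1) (ν : ℝ) :
    HasCoherence (qubitState p ν) ν := by
  have h01 : qubitState p ν 0 1 = ((ν * √(p * (1 - p)) : ℝ) : ℂ) := rfl
  rw [HasCoherence, population_qubitState, h01, Complex.norm_real, Real.norm_eq_abs, sq_abs,
    mul_pow, Real.sq_sqrt (mul_nonneg hp.1 (sub_nonneg.2 hp.2))]

lemma HasCoherence.neg {ρ : Matrix (Fin 2) (Fin 2) ℂ} {ν : ℝ} (h : HasCoherence ρ (-ν)) :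
    HasCoherence ρ ν := by
  rwa [HasCoherence, neg_sq] at h

lemma half_smul_qubitState_add (p ν : ℝ) :
    ((1 / 2 : ℝ) : ℂ) • qubitState p ν + ((1 / 2 : ℝ) : ℂ) • qubitState p (-ν)
      = qubitState p 0 := by
  ext i j
  fin_cases i <;> fin_cases j <;> simp [qubitState] <;> ring

variable {A : Type*} [Fintype A] {η p ν : ℝ} {e : Ensemble (Fin 2) A (Fin 2)}

lemma IsSymmetricEnsemble.population_inputState (he : IsSymmetricEnsemble p ν e) (x : Fin 2) :
    population (e.inputState x) = p := by
  fin_cases x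
  · exact (congrArg population he.2.1).trans (population_qubitState p ν)
  · exact (congrArg population he.2.2).trans (population_qubitState p (-ν))

lemma IsSymmetricEnsemble.hasCoherence_inputState (hp : p ∈ Icc (0 : ℝ) 1)
    (he : IsSymmetricEnsemble p ν e) (x : Fin 2) : HasCoherence (e.inputState x) ν := by
  fin_cases x
  · exact he.2.1.symm ▸ hasCoherence_qubitState hp ν
  · exact (he.2.2.symm ▸ hasCoherence_qubitState hp (-ν) : HasCoherence _ (-ν)).neg

lemma IsSymmetricEnsemble.sum_inputState (he : IsSymmetricEnsemble p ν e) :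
    ∑ x, (e.prob x : ℂ) • e.inputState x = qubitState p 0 := by
  rw [Fin.sum_univ_two, he.1, he.1, he.2.1, he.2.2, half_smul_qubitState_add]

variable [DecidableEq A]

theorem IsSymmetricEnsemble.coherentInfo_eq (hη : η ∈ Icc (0 : ℝ) 1) (hp : p ∈ Icc (0 : ℝ) 1)
    (he : IsSymmetricEnsemble p ν e) :
    e.coherentInfo (amplitudeDamping η) = g p η ν - g p (1 - η) ν := by
  rw [e.coherentInfo_amplitudeDamping hη (he.hasCoherence_inputState hp)]
  simp only [he.population_inputState, ← Finset.sum_mul, e.prob_sum, one_mul]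

theorem IsSymmetricEnsemble.holevoInfo_add_coherentInfo_eq (hη : η ∈ Icc (0 : ℝ) 1)
    (hp : p ∈ Icc (0 : ℝ) 1) (he : IsSymmetricEnsemble p ν e) :
    e.holevoInfo (amplitudeDamping η) + e.coherentInfo (amplitudeDamping η)
      = h2 (η * p) - g p (1 - η) ν := by
  rw [e.holevoInfo_add_coherentInfo_amplitudeDamping hη (he.hasCoherence_inputState hp)
    (he.sum_inputState.symm ▸ hasCoherence_qubitState hp 0)]
  simp only [he.population_inputState, ← Finset.sum_mul, e.prob_sum, one_mul, g_zero]

/-- A purification of `qubitState p ν`. -/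
def purification (p ν : ℝ) : Fin 2 × Fin 2 → ℂ := fun i =>
  ((!![ν * √(1 - p), √p; √(1 - ν ^ 2) * √(1 - p), 0] i.1 i.2 : ℝ) : ℂ)

lemma traceLeft_ketBra_purification (hp : p ∈ Icc (0 : ℝ) 1) (hν : ν ^ 2 ≤ 1) :
    traceLeft (ketBra (purification p ν)) = qubitState p ν := by
  have hsqp := Real.mul_self_sqrt hp.1
  have hsqp' := Real.mul_self_sqrt (sub_nonneg.2 hp.2)
  have hsqν := Real.mul_self_sqrt (sub_nonneg.2 hν)
  rw [qubitState, Real.sqrt_mul hp.1]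
  ext i j
  fin_cases i <;> fin_cases j <;>
    simp [traceLeft, ketBra, purification, Matrix.vecMulVec_apply] <;> norm_cast
  · linear_combination (ν ^ 2 + √(1 - ν ^ 2) * √(1 - ν ^ 2)) * hsqp' + (1 - p) * hsqν
  · ring
  · ring

lemma sum_norm_purification_sq (hp : p ∈ Icc (0 : ℝ) 1) (hν : ν ^ 2 ≤ 1) :
    ∑ i, ‖purification p ν i‖ ^ 2 = 1 := by
  have htr : ((∑ i, ‖purification p ν i‖ ^ 2 : ℝ) : ℂ) = 1 := by
    rw [← trace_ketBra, ← trace_traceLeft, traceLeft_ketBra_purification hp hν, qubitState,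
      Matrix.trace_fin_two_of, ← Complex.ofReal_add, sub_add_cancel, Complex.ofReal_one]
  exact_mod_cast htr

lemma exists_isSymmetricEnsemble (hp : p ∈ Icc (0 : ℝ) 1) (hν : ν ^ 2 ≤ 1) :
    ∃ e : Ensemble (Fin 2) (Fin 2) (Fin 2), IsSymmetricEnsemble p ν e := by
  have hν' : (-ν) ^ 2 ≤ 1 := by rwa [neg_sq]
  refine ⟨⟨fun _ => 1 / 2, fun _ => by norm_num, by norm_num [Fin.sum_univ_two],
    ![purification p ν, purification p (-ν)], fun x => ?_⟩, fun _ => rfl,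
    traceLeft_ketBra_purification hp hν, traceLeft_ketBra_purification hp hν'⟩
  fin_cases x
  · exact sum_norm_purification_sq hp hν
  · exact sum_norm_purification_sq hp hν'

end Symmetric

theorem tradeoffRegion_amplitudeDamping {η : ℝ} (hη : η ∈ Icc (0 : ℝ) 1) :
    tradeoffRegion (amplitudeDamping η)
      = ⋃ p ∈ Icc (0 : ℝ) 1, ⋃ ν ∈ Icc (0 : ℝ) 1, polyhedron η p ν := by
  ext ⟨C, Q⟩
  simp only [mem_iUnion, exists_prop]
  constructor
  · rintro ⟨k, d, e, hQ, hCQ⟩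
    obtain ⟨p, hp, ν, hν, hcoh, hsum⟩ := e.exists_dominating_parameters hη
    exact ⟨p, hp, ν, hν, hQ.trans hcoh, hCQ.trans hsum⟩
  · rintro ⟨p, hp, ν, hν, hQ, hCQ⟩
    obtain ⟨e, he⟩ := exists_isSymmetricEnsemble hp (pow_le_one₀ hν.1 hν.2)
    exact ⟨2, 2, e, hQ.trans_eq (he.coherentInfo_eq hη hp).symm,
      hCQ.trans_eq (he.holevoInfo_add_coherentInfo_eq hη hp).symm⟩

end CQTradeoff

end

theorem theorem2_general (η : ℝ) (hη : 0 ≤ η) (hη1 : η ≤ 1) :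
    CQTradeoff.tradeoffRegion (CQTradeoff.amplitudeDamping η) =
        (⋃ p ∈ Set.Icc (0 : ℝ) 1, ⋃ ν ∈ Set.Icc (0 : ℝ) 1, CQTradeoff.polyhedron η p ν) ∧
      ∀ p ∈ Set.Icc (0 : ℝ) 1, ∀ ν ∈ Set.Icc (0 : ℝ) 1,
        (∃ e : CQTradeoff.Ensemble (Fin 2) (Fin 2) (Fin 2),
          CQTradeoff.IsSymmetricEnsemble p ν e) ∧
        ∀ (d : ℕ) (e : CQTradeoff.Ensemble (Fin 2) (Fin d) (Fin 2)),
          CQTradeoff.IsSymmetricEnsemble p ν e →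
            e.coherentInfo (CQTradeoff.amplitudeDamping η) =
                CQTradeoff.g p η ν - CQTradeoff.g p (1 - η) ν ∧
              e.holevoInfo (CQTradeoff.amplitudeDamping η) +
                  e.coherentInfo (CQTradeoff.amplitudeDamping η) =
                CQTradeoff.h2 (η * p) - CQTradeoff.g p (1 - η) ν :=
  ⟨CQTradeoff.tradeoffRegion_amplitudeDamping ⟨hη, hη1⟩, fun _ hp _ hν =>
    ⟨CQTradeoff.exists_isSymmetricEnsemble hp (pow_le_one₀ hν.1 hν.2), fun _ _ he =>
      ⟨he.coherentInfo_eq ⟨hη, hη1⟩ hp, he.holevoInfo_add_coherentInfo_eq ⟨hη, hη1⟩ hp⟩⟩⟩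

theorem theorem2 (η : ℝ) (hη : 1 / 2 ≤ η) (hη1 : η ≤ 1) :
    CQTradeoff.tradeoffRegion (CQTradeoff.amplitudeDamping η) =
        (⋃ p ∈ Set.Icc (0 : ℝ) 1, ⋃ ν ∈ Set.Icc (0 : ℝ) 1, CQTradeoff.polyhedron η p ν) ∧
      ∀ p ∈ Set.Icc (0 : ℝ) 1, ∀ ν ∈ Set.Icc (0 : ℝ) 1,
        (∃ e : CQTradeoff.Ensemble (Fin 2) (Fin 2) (Fin 2),
          CQTradeoff.IsSymmetricEnsemble p ν e) ∧
        ∀ (d : ℕ) (e : CQTradeoff.Ensemble (Fin 2) (Fin d) (Fin 2)),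
          CQTradeoff.IsSymmetricEnsemble p ν e →
            e.coherentInfo (CQTradeoff.amplitudeDamping η) =
                CQTradeoff.g p η ν - CQTradeoff.g p (1 - η) ν ∧
              e.holevoInfo (CQTradeoff.amplitudeDamping η) +
                  e.coherentInfo (CQTradeoff.amplitudeDamping η) =
                CQTradeoff.h2 (η * p) - CQTradeoff.g p (1 - η) ν :=
  theorem2_general η (one_half_pos.le.trans hη) hη1
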